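/- Let $N\ge 1$, let $\Omega\subset\mathbb{R}^N$ be an arbitrary bounded open set, let $0<s<1$, and put $$C_{N,s}=\frac{s\,2^{2s}\,\Gamma\left(\frac{2s+N}{2}\right)}{\pi^{N/2}\,\Gamma(1-s)} .$$ All functions are real-valued and identified when equal almost everywhere. For $0<\sigma<1$ let $W^{\sigma,2}(\mathbb{R}^N)$ be the space of all $u\in L^2(\mathbb{R}^N)$ with $$\int_{\mathbb{R}^N}\int_{\mathbb{R}^N}\frac{|u(x)-u(y)|^2}{|x-y|^{N+2\sigma}}\,dx\,dy<\infty ;$$ let $W^{1,2}(\mathbb{R}^N)$ be the usual Sobolev space, and, for $0<\sigma<1$, let $W^{1+\sigma,2}(\mathbb{R}^N)$ be the space of all $u\in W^{1,2}(\mathbb{R}^N)$ whose first-order weak partial derivatives all belong to $W^{\sigma,2}(\mathbb{R}^N)$. Let $$W^{s,2}_0(\overline\Omega)=\{u\in W^{s,2}(\mathbb{R}^N):\ u=0 \text{ a.e. on } \mathbb{R}^N\setminus\Omega\},$$ and let $W^{2s,2}_{\rm loc}(\Omega)$ be the space of all $u\in L^2(\Omega)$ such that $\eta u$, extended by $0$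 outside $\Omega$, belongs to $W^{2s,2}(\mathbb{R}^N)$ for every $\eta\in C_c^\infty(\Omega)$. **Theorem 1.3 ($L^2$-local regularity).** Let $f\in L^2(\Omega)$. Then the Dirichlet problem $$(-\Delta)^s u=f \ \text{ in } \Omega,\qquad u=0 \ \text{ on } \mathbb{R}^N\setminus\Omega,$$ has a unique finite energy weak solution, that is, there is a unique $u\in W^{s,2}_0(\overline\Omega)$ with $$\frac{C_{N,s}}{2}\int_{\mathbb{R}^N}\int_{\mathbb{R}^N}\frac{(u(x)-u(y))(v(x)-v(y))}{|x-y|^{N+2s}}\,dx\,dy=\int_\Omega f v\,dx \qquad\text{for every } v\in W^{s,2}_0(\overline\Omega),$$ and this solution satisfies $u\in W^{2s,2}_{\rm loc}(\Omega)$. -/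

import Mathlib

open MeasureTheory
open scoped Distributions ENNReal

noncomputable section

namespace FracDirichlet

/-- The square of the Gagliardo seminorm of order `σ` on `ℝ^N`:
`∫∫ |u(x) - u(y)|² / |x - y|^(N + 2σ) dx dy`, as an extended nonnegative number. -/
def gagliardoSq {N : ℕ} (σ : ℝ) (u : EuclideanSpace ℝ (Fin N) → ℝ) : ℝ≥0∞ :=
  ∫⁻ z : EuclideanSpace ℝ (Fin N) × EuclideanSpace ℝ (Fin N),
    ENNReal.ofReal ((u z.1 - u z.2) ^ 2 / ‖z.1 - z.2‖ ^ ((N : ℝ) + 2 * σ))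

/-- `g` is the weak (distributional) partial derivative `∂ᵢ u` on `ℝ^N`. -/
def HasWeakPartialDeriv {N : ℕ} (i : Fin N) (u g : EuclideanSpace ℝ (Fin N) → ℝ) : Prop :=
  LocallyIntegrable u volume ∧ LocallyIntegrable g volume ∧
    ∀ φ : 𝓓((⊤ : TopologicalSpace.Opens (EuclideanSpace ℝ (Fin N))), ℝ),
      ∫ x, u x * fderiv ℝ (fun y => φ y) x (EuclideanSpace.single i (1 : ℝ)) = - ∫ x, g x * φ x

/-- Membership in `W^{m+σ,2}(ℝ^N)`, for `m` a natural number and `0 ≤ σ < 1`.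
For `m = 0` this is `L²` if `σ = 0`, and `L²` with finite Gagliardo seminorm of order `σ` if
`σ > 0`. For larger order, `u ∈ L²` and all first weak partial derivatives belong to the space of
order one less; unfolding the recursion, the weak derivatives up to order `m` are in `L²` and those
of order exactly `m` are in `W^{σ,2}`. -/
def MemSobolevAux {N : ℕ} (σ : ℝ) : ℕ → (EuclideanSpace ℝ (Fin N) → ℝ) → Prop
  | 0, u => MemLp u 2 volume ∧ (0 < σ → gagliardoSq σ u < ∞)
  | m + 1, u => MemLp u 2 volume ∧
      ∀ i : Fin N, ∃ g, HasWeakPartialDeriv i u g ∧ MemSobolevAux σ m g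

/-- Membership in the fractional order Sobolev space `W^{r,2}(ℝ^N)`, `r ≥ 0`. -/
def MemSobolev {N : ℕ} (r : ℝ) (u : EuclideanSpace ℝ (Fin N) → ℝ) : Prop :=
  MemSobolevAux (Int.fract r) ⌊r⌋₊ u

/-- Membership in `W₀^{s,2}(Ω̄)`: functions in `W^{s,2}(ℝ^N)` that vanish (a.e.) outside `Ω`. -/
def MemSobolevZero {N : ℕ} (s : ℝ) (Ω : TopologicalSpace.Opens (EuclideanSpace ℝ (Fin N)))
    (u : EuclideanSpace ℝ (Fin N) → ℝ) : Prop :=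
  MemSobolev s u ∧ ∀ᵐ x, x ∉ Ω → u x = 0

/-- Membership in `W^{r,2}_loc(Ω)`: `u ∈ L²(Ω)` and `η u ∈ W^{r,2}(ℝ^N)` for every test function
`η ∈ 𝓓(Ω)`. -/
def MemSobolevLoc {N : ℕ} (r : ℝ) (Ω : TopologicalSpace.Opens (EuclideanSpace ℝ (Fin N)))
    (u : EuclideanSpace ℝ (Fin N) → ℝ) : Prop :=
  MemLp u 2 (volume.restrict (Ω : Set (EuclideanSpace ℝ (Fin N)))) ∧
    ∀ η : 𝓓(Ω, ℝ), MemSobolev r (fun x => η x * u x)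

/-- The normalization constant `C_{N,s}` of the fractional Laplacian `(-Δ)^s` on `ℝ^N`. -/
def fracLapConst (N : ℕ) (s : ℝ) : ℝ :=
  s * 2 ^ (2 * s) * Real.Gamma ((2 * s + N) / 2) /
    (Real.pi ^ ((N : ℝ) / 2) * Real.Gamma (1 - s))

/-- The bilinear form
`𝓔(u,v) = (C_{N,s}/2) ∫∫ (u(x) - u(y)) (v(x) - v(y)) / |x - y|^(N + 2s) dx dy` of `(-Δ)^s`. -/
def energyForm {N : ℕ} (s : ℝ) (u v : EuclideanSpace ℝ (Fin N) → ℝ) : ℝ :=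
  fracLapConst N s / 2 *
    ∫ z : EuclideanSpace ℝ (Fin N) × EuclideanSpace ℝ (Fin N),
      (u z.1 - u z.2) * (v z.1 - v z.2) / ‖z.1 - z.2‖ ^ ((N : ℝ) + 2 * s)

/-- `u` is a finite energy weak solution of `(-Δ)^s u = f` in `Ω`, `u = 0` on `ℝ^N \ Ω`, with
right-hand side `f ∈ L²(Ω)` acting on `W₀^{s,2}(Ω̄)` by `⟨f, v⟩ = ∫_Ω f v`. -/
def IsWeakSolution {N : ℕ} (s : ℝ) (Ω : TopologicalSpace.Opens (EuclideanSpace ℝ (Fin N)))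
    (f u : EuclideanSpace ℝ (Fin N) → ℝ) : Prop :=
  MemSobolevZero s Ω u ∧
    ∀ v, MemSobolevZero s Ω v →
      energyForm s u v = ∫ x in (Ω : Set (EuclideanSpace ℝ (Fin N))), f x * v x

end FracDirichlet

end

/-! Existence and uniqueness are Hilbert space arguments. The weighted difference `gagGrad s u`
turns the energy form into an `L²(ℝ^N × ℝ^N)` inner product. Because `Ω` is bounded, a Poincaré
inequality bounds `‖u‖` by `‖gagGrad s u‖`; hence the range of `gagGradₗ` is closed, Riesz
representation on it produces a solution, and a difference of two solutions has zero energy and must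
vanish.

Regularity rests on localization. For a cutoff `η`, the commutator `𝓔(ηu, φ) - 𝓔(u, ηφ)` is bounded
by `K‖φ‖₂`, with no derivative falling on `φ` (`IsCutoff.exists_commutator_bound`). A first
difference of `η` can be absorbed by Cauchy–Schwarz against `gagGrad s u`; the remaining term pairs
`uφ` with a truncated fractional Laplacian of `η`, which is bounded because symmetrization replaces
first differences by second differences. Since `ηφ` is an admissible test function, `𝓔(u, ηφ) = ∫
fηφ` is also `O(‖φ‖₂)`. So `φ ↦ 𝓔(ηu, φ)` is `L²`-bounded on all of `W^{s,2}(ℝ^N)`.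

On the Fourier side the seminorm has a multiplier `symbol s`, comparable to `|ξ|^{2s}` (`symbol_le`,
`exists_le_symbol`). Testing with truncated multiples of the transform of `w = ηu` shows that
`symbol s · ŵ` is in `L²` (`norm_truncSymbol_le`, `lintegral_symbol_sq_lt_top`), so `|ξ|^{2s} ŵ ∈
L²`. This decay is then translated back into `W^{2s,2}`, directly when `2s < 1` and through weak
derivatives when `2s ≥ 1`. -/

namespace FracDirichlet

open scoped FourierTransform SchwartzMap

/-! ### The fractional kernel and the Gagliardo seminorm -/

section

variable {N : ℕ}

/-- The kernel `|h|^{-(N+2σ)}`. -/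
noncomputable def fracKer (σ : ℝ) (h : EuclideanSpace ℝ (Fin N)) : ℝ :=
  (‖h‖ ^ ((N : ℝ) + 2 * σ))⁻¹

lemma fracKer_nonneg (σ : ℝ) (h : EuclideanSpace ℝ (Fin N)) : 0 ≤ fracKer σ h :=
  inv_nonneg.2 (Real.rpow_nonneg (norm_nonneg _) _)

lemma fracKer_neg (σ : ℝ) (h : EuclideanSpace ℝ (Fin N)) : fracKer σ (-h) = fracKer σ h := by
  simp [fracKer]

lemma fracKer_sub_comm (σ : ℝ) (x y : EuclideanSpace ℝ (Fin N)) :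
    fracKer σ (x - y) = fracKer σ (y - x) := by
  rw [← fracKer_neg, neg_sub]

@[fun_prop]
lemma measurable_fracKer (σ : ℝ) :
    Measurable (fracKer σ : EuclideanSpace ℝ (Fin N) → ℝ) := by
  unfold fracKer; fun_prop

lemma fracLapConst_pos (hN : 1 ≤ N) {s : ℝ} (hs0 : 0 < s) (hs1 : s < 1) :
    0 < fracLapConst N s := by
  unfold fracLapConst
  have h1 : 0 < Real.Gamma ((2 * s + N) / 2) := Real.Gamma_pos_of_pos (by positivity)
  have h2 : 0 < Real.Gamma (1 - s) := Real.Gamma_pos_of_pos (by linarith)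
  positivity

/-- In polar coordinates the radial density is `r^(1-2σ)` on `(0,1]`, integrable since `σ < 1`, and
`r^(-1-2σ)` beyond `1`, integrable since `σ > 0`. -/
lemma integrable_min_mul_fracKer (hN : 1 ≤ N) {σ : ℝ} (h0 : 0 < σ) (h1 : σ < 1) :
    Integrable (fun h : EuclideanSpace ℝ (Fin N) => min 1 (‖h‖ ^ 2) * fracKer σ h) := by
  have : Nontrivial (EuclideanSpace ℝ (Fin N)) := by
    have : Nonempty (Fin N) := ⟨⟨0, hN⟩⟩
    infer_instance
  have key := (integrable_fun_norm_addHaar (volume : Measure (EuclideanSpace ℝ (Fin N)))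
    (f := fun r => min 1 (r ^ 2) * (r ^ ((N : ℝ) + 2 * σ))⁻¹)).2 ?_
  · exact key
  rw [← Set.Ioc_union_Ioi_eq_Ioi zero_le_one]
  have hpow : ∀ r : ℝ, 0 < r → r ^ (N - 1) * (r ^ ((N : ℝ) + 2 * σ))⁻¹ = r ^ (-1 - 2 * σ) := by
    intro r hr
    rw [← Real.rpow_natCast, ← Real.rpow_neg hr.le, ← Real.rpow_add hr]
    push_cast [hN]
    ring_nf
  refine IntegrableOn.union ?_ ?_
  · have : IntegrableOn (fun r : ℝ => r ^ (1 - 2 * σ)) (Set.Ioc 0 1) := by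
      rw [← intervalIntegrable_iff_integrableOn_Ioc_of_le zero_le_one]
      exact intervalIntegral.intervalIntegrable_rpow' (by linarith)
    refine this.congr_fun (fun r hr => ?_) measurableSet_Ioc
    have hr2 : min 1 (r ^ 2) = r ^ (2 : ℝ) := by
      rw [min_eq_right (by nlinarith [hr.1, hr.2])]; norm_cast
    simp only [finrank_euclideanSpace, Fintype.card_fin, smul_eq_mul]
    rw [hr2, mul_left_comm, hpow r hr.1, ← Real.rpow_add hr.1]
    ring_nf
  · have : IntegrableOn (fun r : ℝ => r ^ (-1 - 2 * σ)) (Set.Ioi 1) :=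
      integrableOn_Ioi_rpow_of_lt (by linarith) zero_lt_one
    refine this.congr_fun (fun r hr => ?_) measurableSet_Ioi
    have hr0 : (1 : ℝ) < r := hr
    have hr2 : min 1 (r ^ 2) = (1 : ℝ) := min_eq_left (by nlinarith)
    simp only [finrank_euclideanSpace, Fintype.card_fin, smul_eq_mul]
    rw [hr2, one_mul, hpow r (by linarith)]

/-- The integral `∫ min(1,|h|²) |h|^{-(N+2σ)} dh`. -/
noncomputable def kerMass (N : ℕ) (σ : ℝ) : ℝ :=
  ∫ h : EuclideanSpace ℝ (Fin N), min 1 (‖h‖ ^ 2) * fracKer σ h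

lemma kerMass_nonneg (σ : ℝ) : 0 ≤ kerMass N σ :=
  integral_nonneg fun h => mul_nonneg (by positivity) (fracKer_nonneg σ h)

lemma lintegral_min_mul_fracKer (hN : 1 ≤ N) {σ : ℝ} (h0 : 0 < σ) (h1 : σ < 1) :
    ∫⁻ h : EuclideanSpace ℝ (Fin N), ENNReal.ofReal (min 1 (‖h‖ ^ 2)) *
      ENNReal.ofReal (fracKer σ h) = ENNReal.ofReal (kerMass N σ) := by
  rw [kerMass, ofReal_integral_eq_lintegral_ofReal (integrable_min_mul_fracKer hN h0 h1)
    (.of_forall fun h => mul_nonneg (by positivity) (fracKer_nonneg σ h))]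
  simp_rw [ENNReal.ofReal_mul (le_min zero_le_one (sq_nonneg _))]

variable {F : Type*} [NormedAddCommGroup F]

/-- The squared Gagliardo seminorm of a vector-valued function. -/
noncomputable def seminormSq (σ : ℝ) (u : EuclideanSpace ℝ (Fin N) → F) : ℝ≥0∞ :=
  ∫⁻ z : EuclideanSpace ℝ (Fin N) × EuclideanSpace ℝ (Fin N),
    ‖u z.1 - u z.2‖ₑ ^ 2 * ENNReal.ofReal (fracKer σ (z.1 - z.2))

lemma enorm_sq_eq_ofReal (a : F) : ‖a‖ₑ ^ 2 = ENNReal.ofReal (‖a‖ ^ 2) := by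
  rw [← ofReal_norm, ENNReal.ofReal_pow (norm_nonneg _)]

lemma gagliardoSq_eq_seminormSq (σ : ℝ) (u : EuclideanSpace ℝ (Fin N) → ℝ) :
    gagliardoSq σ u = seminormSq σ u := by
  unfold gagliardoSq seminormSq
  congr 1; ext z
  rw [enorm_sq_eq_ofReal, ← ENNReal.ofReal_mul (sq_nonneg _), Real.norm_eq_abs, sq_abs, fracKer,
    div_eq_mul_inv]

lemma ae_prod_of_ae {p : EuclideanSpace ℝ (Fin N) → Prop} (h : ∀ᵐ x, p x) :
    ∀ᵐ z : EuclideanSpace ℝ (Fin N) × EuclideanSpace ℝ (Fin N), p z.1 ∧ p z.2 := by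
  have h1 := (Measure.quasiMeasurePreserving_fst (μ := (volume : Measure (EuclideanSpace ℝ (Fin N))))
    (ν := (volume : Measure (EuclideanSpace ℝ (Fin N))))).ae h
  have h2 := (Measure.quasiMeasurePreserving_snd (μ := (volume : Measure (EuclideanSpace ℝ (Fin N))))
    (ν := (volume : Measure (EuclideanSpace ℝ (Fin N))))).ae h
  filter_upwards [h1, h2] with z h1 h2 using ⟨h1, h2⟩

lemma seminormSq_congr_ae {σ : ℝ} {u v : EuclideanSpace ℝ (Fin N) → F} (h : u =ᵐ[volume] v) :
    seminormSq σ u = seminormSq σ v := by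
  refine lintegral_congr_ae ?_
  filter_upwards [ae_prod_of_ae h] with z hz
  simp only [hz.1, hz.2]

/-- Substitute `x = y + h` and apply Tonelli. The inner integral becomes the squared `L²` norm of a
translation difference, the form to which Plancherel applies. A strongly measurable representative
supplies the joint measurability. -/
lemma seminormSq_eq_lintegral_lintegral (σ : ℝ) {u : EuclideanSpace ℝ (Fin N) → F}
    (hu : AEStronglyMeasurable u volume) :
    seminormSq σ u = ∫⁻ h : EuclideanSpace ℝ (Fin N), ENNReal.ofReal (fracKer σ h) *
      ∫⁻ x, ‖u (x + h) - u x‖ₑ ^ 2 := by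
  have hm := hu.stronglyMeasurable_mk
  have h1 : ∀ h : EuclideanSpace ℝ (Fin N), ∫⁻ x, ‖u (x + h) - u x‖ₑ ^ 2 =
      ∫⁻ x, ‖hu.mk u (x + h) - hu.mk u x‖ₑ ^ 2 := by
    intro h
    refine lintegral_congr_ae ?_
    filter_upwards [hu.ae_eq_mk,
      (measurePreserving_add_right volume h).quasiMeasurePreserving.ae_eq_comp hu.ae_eq_mk]
      with x h1 h2
    simp only [Function.comp_apply] at h2
    rw [h1, h2]
  simp_rw [h1]
  rw [seminormSq_congr_ae hu.ae_eq_mk]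
  set v := hu.mk u
  have hv : ∀ {α : Type} [MeasurableSpace α] {a b : α → EuclideanSpace ℝ (Fin N)},
      Measurable a → Measurable b → Measurable fun t => ‖v (a t) - v (b t)‖ₑ ^ 2 :=
    fun ha hb => ((hm.comp_measurable ha).sub (hm.comp_measurable hb)).enorm.pow_const 2
  have hz : Measurable fun z : EuclideanSpace ℝ (Fin N) × EuclideanSpace ℝ (Fin N) =>
      ‖v z.1 - v z.2‖ₑ ^ 2 * ENNReal.ofReal (fracKer σ (z.1 - z.2)) :=
    (hv measurable_fst measurable_snd).mul (by fun_prop)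
  rw [seminormSq, Measure.volume_eq_prod, lintegral_prod_symm' _ hz]
  have h2 : ∀ y : EuclideanSpace ℝ (Fin N),
      ∫⁻ x, ‖v x - v y‖ₑ ^ 2 * ENNReal.ofReal (fracKer σ (x - y)) =
      ∫⁻ h, ‖v (y + h) - v y‖ₑ ^ 2 * ENNReal.ofReal (fracKer σ h) := by
    intro y
    rw [← lintegral_add_left_eq_self _ y]
    simp
  simp_rw [h2]
  rw [lintegral_lintegral_swap]
  · congr 1; ext h
    rw [lintegral_mul_const _ (hv (by fun_prop) (by fun_prop)), mul_comm]
  · exact ((hv (by fun_prop) (by fun_prop)).mul (by fun_prop)).aemeasurable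

lemma lintegral_enorm_sq_eq {α : Type*} [MeasurableSpace α] {μ : Measure α} (u : α → F) :
    ∫⁻ x, ‖u x‖ₑ ^ 2 ∂μ = eLpNorm u 2 μ ^ 2 := by
  have := eLpNorm_nnreal_pow_eq_lintegral (f := u) (μ := μ) (p := 2) (by norm_num)
  simpa using this.symm

lemma memLp_two_iff {α : Type*} [MeasurableSpace α] {μ : Measure α} {u : α → F} :
    MemLp u 2 μ ↔ AEStronglyMeasurable u μ ∧ ∫⁻ x, ‖u x‖ₑ ^ 2 ∂μ < ∞ := by
  rw [lintegral_enorm_sq_eq, MemLp]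
  simp [ENNReal.pow_lt_top_iff]

end

/-! ### Poincaré inequality and multiplication by cutoffs -/

section

variable {N : ℕ} {F : Type*} [NormedAddCommGroup F]

lemma aemeasurable_seminormSq_integrand (σ : ℝ) {u : EuclideanSpace ℝ (Fin N) → F}
    (hu : AEStronglyMeasurable u volume) :
    AEMeasurable (fun z : EuclideanSpace ℝ (Fin N) × EuclideanSpace ℝ (Fin N) =>
      ‖u z.1 - u z.2‖ₑ ^ 2 * ENNReal.ofReal (fracKer σ (z.1 - z.2))) := by
  rw [Measure.volume_eq_prod]
  have h1 : Measurable fun z : EuclideanSpace ℝ (Fin N) × EuclideanSpace ℝ (Fin N) =>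
      ENNReal.ofReal (fracKer σ (z.1 - z.2)) := by fun_prop
  exact ((hu.comp_fst.sub hu.comp_snd).enorm.pow_const 2).mul h1.aemeasurable

/-- Poincaré inequality for functions vanishing outside a bounded set. -/
lemma exists_poincare (hN : 1 ≤ N) {s : ℝ} (hs : 0 < s) {Ω : Set (EuclideanSpace ℝ (Fin N))}
    (hΩ : Bornology.IsBounded Ω) :
    ∃ C : ℝ≥0∞, C ≠ ∞ ∧ ∀ u : EuclideanSpace ℝ (Fin N) → F, AEStronglyMeasurable u volume →
      (∀ᵐ x, x ∉ Ω → u x = 0) → ∫⁻ x, ‖u x‖ₑ ^ 2 ≤ C * seminormSq s u := by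
  have : Nontrivial (EuclideanSpace ℝ (Fin N)) := by
    have : Nonempty (Fin N) := ⟨⟨0, hN⟩⟩
    infer_instance
  obtain ⟨R, hR0, hR⟩ := hΩ.subset_closedBall_lt 0 0
  -- With `‖c‖ = R + 2` the unit ball around `c` misses `Ω`, so `u` vanishes a.e. there, and its
  -- points are within `2R + 3` of every point of `Ω`. Restricting the `y`-integral to this ball
  -- leaves `‖u x‖²` times a positive constant.
  obtain ⟨c, hc⟩ := exists_norm_eq (EuclideanSpace ℝ (Fin N)) (show 0 ≤ R + 2 by linarith)
  set κ : ℝ := ((2 * R + 3) ^ ((N : ℝ) + 2 * s))⁻¹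
  have hκ : 0 < κ := by positivity
  have hxΩ : ∀ x ∈ Ω, ‖x‖ ≤ R := fun x hx => by simpa using hR hx
  have hA : ∀ y ∈ Metric.ball c 1, R + 1 < ‖y‖ ∧ ‖y‖ < R + 3 := by
    intro y hy
    have h1 : ‖y - c‖ < 1 := by simpa [dist_eq_norm] using hy
    have h2 := norm_sub_norm_le c y
    have h3 := norm_sub_norm_le y c
    rw [norm_sub_rev] at h2
    constructor <;> linarith
  have hker : ∀ x ∈ Ω, ∀ y ∈ Metric.ball c 1, κ ≤ fracKer s (x - y) := by
    intro x hx y hy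
    have h1 := hxΩ x hx
    have h2 := hA y hy
    have h3 : 0 < ‖x - y‖ := by
      rw [norm_pos_iff, sub_ne_zero]; rintro rfl; linarith
    have h4 : ‖x - y‖ ≤ 2 * R + 3 := (norm_sub_le _ _).trans (by linarith)
    exact inv_anti₀ (by positivity) (Real.rpow_le_rpow h3.le h4 (by positivity))
  set a : ℝ≥0∞ := ENNReal.ofReal κ * volume (Metric.ball c 1)
  have ha0 : a ≠ 0 := mul_ne_zero (by simpa using hκ) (Metric.measure_ball_pos _ _ one_pos).ne'
  have ha1 : a ≠ ∞ := ENNReal.mul_ne_top ENNReal.ofReal_ne_top measure_ball_lt_top.ne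
  refine ⟨a⁻¹, ENNReal.inv_ne_top.2 ha0, fun u hu hu0 => ?_⟩
  rw [mul_comm, ← div_eq_mul_inv, ENNReal.le_div_iff_mul_le (.inl ha0) (.inl ha1),
    seminormSq, Measure.volume_eq_prod, lintegral_prod _ (aemeasurable_seminormSq_integrand s hu),
    ← lintegral_mul_const' _ _ ha1]
  refine lintegral_mono_ae ?_
  filter_upwards [hu0] with x hx0
  by_cases hx : x ∈ Ω
  swap
  · simp [hx0 hx]
  calc ‖u x‖ₑ ^ 2 * a = ∫⁻ y in Metric.ball c 1, ‖u x‖ₑ ^ 2 * ENNReal.ofReal κ := by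
        rw [setLIntegral_const, mul_assoc]
    _ ≤ ∫⁻ y in Metric.ball c 1, ‖u x - u y‖ₑ ^ 2 * ENNReal.ofReal (fracKer s (x - y)) := by
        refine setLIntegral_mono_ae' measurableSet_ball ?_
        filter_upwards [hu0] with y hy0 hy
        have : y ∉ Ω := fun h => by linarith [hxΩ y h, (hA y hy).1]
        rw [hy0 this, sub_zero]
        gcongr
        exact hker x hx y hy
    _ ≤ _ := setLIntegral_le_lintegral _ _

lemma lintegral_snd_mul_fracKer (hN : 1 ≤ N) {σ : ℝ} (h0 : 0 < σ) (h1 : σ < 1)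
    {p : EuclideanSpace ℝ (Fin N) → ℝ≥0∞} (hp : AEMeasurable p) :
    ∫⁻ z : EuclideanSpace ℝ (Fin N) × EuclideanSpace ℝ (Fin N), p z.2 *
      (ENNReal.ofReal (min 1 (‖z.1 - z.2‖ ^ 2)) * ENNReal.ofReal (fracKer σ (z.1 - z.2))) =
      (∫⁻ x, p x) * ENNReal.ofReal (kerMass N σ) := by
  have hk : Measurable fun z : EuclideanSpace ℝ (Fin N) × EuclideanSpace ℝ (Fin N) =>
      ENNReal.ofReal (min 1 (‖z.1 - z.2‖ ^ 2)) * ENNReal.ofReal (fracKer σ (z.1 - z.2)) := by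
    fun_prop
  have hz : AEMeasurable (fun z : EuclideanSpace ℝ (Fin N) × EuclideanSpace ℝ (Fin N) => p z.2 *
      (ENNReal.ofReal (min 1 (‖z.1 - z.2‖ ^ 2)) * ENNReal.ofReal (fracKer σ (z.1 - z.2))))
      (volume.prod volume) := hp.comp_snd.mul hk.aemeasurable
  rw [Measure.volume_eq_prod, lintegral_prod_symm _ hz,
    ← lintegral_mul_const' _ _ ENNReal.ofReal_ne_top]
  congr 1; ext y
  simp only
  rw [lintegral_const_mul _ (by fun_prop), ← lintegral_min_mul_fracKer hN h0 h1,
    lintegral_sub_right_eq_self (fun h : EuclideanSpace ℝ (Fin N) =>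
      ENNReal.ofReal (min 1 (‖h‖ ^ 2)) * ENNReal.ofReal (fracKer σ h)) y]

lemma lintegral_fst_mul_fracKer (hN : 1 ≤ N) {σ : ℝ} (h0 : 0 < σ) (h1 : σ < 1)
    {p : EuclideanSpace ℝ (Fin N) → ℝ≥0∞} (hp : AEMeasurable p) :
    ∫⁻ z : EuclideanSpace ℝ (Fin N) × EuclideanSpace ℝ (Fin N), p z.1 *
      (ENNReal.ofReal (min 1 (‖z.1 - z.2‖ ^ 2)) * ENNReal.ofReal (fracKer σ (z.1 - z.2))) =
      (∫⁻ x, p x) * ENNReal.ofReal (kerMass N σ) := by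
  rw [← lintegral_snd_mul_fracKer hN h0 h1 hp, Measure.volume_eq_prod, ← lintegral_prod_swap]
  simp only [Prod.fst_swap, Prod.snd_swap]
  congr 1; ext z
  rw [norm_sub_rev, fracKer_sub_comm]

/-- Quantitative bounds on a function and its first and second differences. -/
structure IsCutoff (η : EuclideanSpace ℝ (Fin N) → ℝ) (B : ℝ) : Prop where
  continuous : Continuous η
  abs_le : ∀ x, |η x| ≤ B
  sq_sub_le : ∀ x y, (η x - η y) ^ 2 ≤ B * min 1 (‖x - y‖ ^ 2)
  second_diff_le : ∀ x h, |2 * η x - η (x + h) - η (x - h)| ≤ B * min 1 (‖h‖ ^ 2)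

lemma IsCutoff.nonneg {η : EuclideanSpace ℝ (Fin N) → ℝ} {B : ℝ} (h : IsCutoff η B) : 0 ≤ B :=
  (abs_nonneg _).trans (h.abs_le 0)

/-- Large increments are controlled by the sup bound of `η`, small ones by the Lipschitz constants
of `η` and of its derivative. The final `B` is a sum that dominates the constant of each estimate.
-/
lemma exists_isCutoff {η : EuclideanSpace ℝ (Fin N) → ℝ} (h1 : ContDiff ℝ ((⊤ : ℕ∞) : WithTop ℕ∞) η)
    (h2 : HasCompactSupport η) : ∃ B, IsCutoff η B := by
  obtain ⟨M, hM⟩ := h2.exists_bound_of_continuous h1.continuous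
  obtain ⟨L, hL⟩ := (h1.of_le (by exact_mod_cast le_top) : ContDiff ℝ 1 η).lipschitzWith_of_hasCompactSupport h2 (by simp)
  have hd : ContDiff ℝ 1 (fderiv ℝ η) :=
    (contDiff_infty.1 h1 2).fderiv_right one_add_one_eq_two.le
  obtain ⟨L', hL'⟩ := hd.lipschitzWith_of_hasCompactSupport (h2.fderiv (𝕜 := ℝ)) (by simp)
  have hM' : ∀ x, |η x| ≤ M := fun x => by simpa using hM x
  have hM0 : 0 ≤ M := (abs_nonneg _).trans (hM' 0)
  have hmin : ∀ {a c : ℝ} (t : ℝ), 0 ≤ a → 0 ≤ c → ∀ {b : ℝ}, b ≤ a → b ≤ c * t ^ 2 →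
      b ≤ (a + c) * min 1 (t ^ 2) := by
    intro a c t ha hc b hb1 hb2
    rcases le_total 1 (t ^ 2) with h | h
    · rw [min_eq_left h]; linarith
    · rw [min_eq_right h]; nlinarith [mul_nonneg ha (sq_nonneg t)]
  have hfirst : ∀ x y, |η x - η y| ≤ L * ‖x - y‖ := fun x y => by
    simpa [dist_eq_norm] using hL.dist_le_mul x y
  have hsecond : ∀ x h, |2 * η x - η (x + h) - η (x - h)| ≤ L' * ‖h‖ ^ 2 := by
    intro x h
    have hdiff : Differentiable ℝ η := h1.differentiable (by simp)
    have hf : ∀ z ∈ (Set.univ : Set (EuclideanSpace ℝ (Fin N))),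
        HasFDerivWithinAt (fun z => η (z + h) - η z) (fderiv ℝ η (z + h) - fderiv ℝ η z)
          Set.univ z := by
      intro z _
      have e1 : HasFDerivAt (fun z => η (z + h)) (fderiv ℝ η (z + h)) z := by
        exact (hasFDerivAt_comp_add_right h).2 (hdiff (z + h)).hasFDerivAt
      exact (e1.sub (hdiff z).hasFDerivAt).hasFDerivWithinAt
    -- The second difference is the increment of `z ↦ η (z + h) - η z` between `x` and `x - h`; the
    -- derivative of this map is at most `L' ‖h‖`, and the step contributes another factor `‖h‖`.
    have := convex_univ.norm_image_sub_le_of_norm_hasFDerivWithin_le hf (C := L' * ‖h‖)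
      (fun z _ => by simpa [dist_eq_norm] using hL'.dist_le_mul (z + h) z)
      (Set.mem_univ x) (Set.mem_univ (x - h))
    rw [Real.norm_eq_abs] at this
    calc _ = |η (x - h + h) - η (x - h) - (η (x + h) - η x)| := by
          rw [sub_add_cancel]; ring_nf
      _ ≤ _ := this
      _ = _ := by simp; ring
  refine ⟨M + (4 * M ^ 2 + L ^ 2) + (4 * M + L'), h1.continuous, fun x => ?_, fun x y => ?_,
    fun x h => ?_⟩
  · have := hM' x
    nlinarith [sq_nonneg M, sq_nonneg (L : ℝ), L'.2]
  · have e1 := abs_le.1 (hM' x)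
    have e2 := abs_le.1 (hM' y)
    have := hmin ‖x - y‖ (a := 4 * M ^ 2) (c := L ^ 2) (by positivity) (by positivity)
      (b := (η x - η y) ^ 2) (by nlinarith) (by
        rw [← sq_abs, ← mul_pow]; gcongr; exact hfirst x y)
    refine this.trans (mul_le_mul_of_nonneg_right ?_ (by positivity))
    nlinarith [L'.2]
  · have e1 := abs_le.1 (hM' x)
    have e2 := abs_le.1 (hM' (x + h))
    have e3 := abs_le.1 (hM' (x - h))
    have := hmin ‖h‖ (a := 4 * M) (c := L') (by positivity) (by positivity)
      (b := |2 * η x - η (x + h) - η (x - h)|) (by rw [abs_le]; constructor <;> linarith)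
      (hsecond x h)
    refine this.trans (mul_le_mul_of_nonneg_right ?_ (by positivity))
    nlinarith [sq_nonneg M, sq_nonneg (L : ℝ)]

/-- Leibniz splitting: `ηu(x) - ηu(y) = η(x)(u(x) - u(y)) + u(y)(η(x) - η(y))`. In the second term
the squared difference of `η` gains `min 1 |x - y|²`, which makes the kernel integrable. -/
lemma IsCutoff.seminormSq_mul_le (hN : 1 ≤ N) {σ : ℝ} (h0 : 0 < σ) (h1 : σ < 1)
    {η : EuclideanSpace ℝ (Fin N) → ℝ} {B : ℝ} (hη : IsCutoff η B)
    {u : EuclideanSpace ℝ (Fin N) → ℝ} (hu : AEStronglyMeasurable u volume) :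
    seminormSq σ (fun x => η x * u x) ≤ ENNReal.ofReal (2 * B ^ 2) * seminormSq σ u +
      ENNReal.ofReal (2 * B) * ((∫⁻ x, ‖u x‖ₑ ^ 2) * ENNReal.ofReal (kerMass N σ)) := by
  rw [← lintegral_snd_mul_fracKer hN h0 h1 (hu.enorm.pow_const 2), seminormSq, seminormSq,
    ← lintegral_const_mul' _ _ ENNReal.ofReal_ne_top,
    ← lintegral_const_mul' _ _ ENNReal.ofReal_ne_top,
    ← lintegral_add_left' ((aemeasurable_seminormSq_integrand σ hu).const_mul _)]
  refine lintegral_mono fun z => ?_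
  have hk := fracKer_nonneg σ (z.1 - z.2)
  have hB := hη.nonneg
  simp only [enorm_sq_eq_ofReal, Real.norm_eq_abs, sq_abs]
  rw [← ENNReal.ofReal_mul (by positivity), ← ENNReal.ofReal_mul (by positivity),
    ← ENNReal.ofReal_mul (by positivity), ← ENNReal.ofReal_mul (by positivity),
    ← ENNReal.ofReal_mul (by positivity), ← ENNReal.ofReal_mul (by positivity),
    ← ENNReal.ofReal_add (by positivity) (by positivity)]
  refine ENNReal.ofReal_le_ofReal ?_
  have e1 : (η z.1 * u z.1 - η z.2 * u z.2) ^ 2 ≤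
      2 * (η z.1 ^ 2 * (u z.1 - u z.2) ^ 2) + 2 * (u z.2 ^ 2 * (η z.1 - η z.2) ^ 2) := by
    nlinarith [sq_nonneg (η z.1 * (u z.1 - u z.2) - u z.2 * (η z.1 - η z.2))]
  have e2 : η z.1 ^ 2 * (u z.1 - u z.2) ^ 2 ≤ B ^ 2 * (u z.1 - u z.2) ^ 2 := by
    gcongr ?_ * _
    rw [← sq_abs]; gcongr; exact hη.abs_le _
  have e3 : u z.2 ^ 2 * (η z.1 - η z.2) ^ 2 ≤ u z.2 ^ 2 * (B * min 1 (‖z.1 - z.2‖ ^ 2)) := by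
    gcongr; exact hη.sq_sub_le _ _
  calc _ ≤ (2 * (B ^ 2 * (u z.1 - u z.2) ^ 2) + 2 * (u z.2 ^ 2 * (B * min 1 (‖z.1 - z.2‖ ^ 2)))) *
        fracKer σ (z.1 - z.2) := by gcongr; linarith
    _ = _ := by ring

lemma memSobolev_iff {s : ℝ} (hs0 : 0 < s) (hs1 : s < 1) {u : EuclideanSpace ℝ (Fin N) → ℝ} :
    MemSobolev s u ↔ MemLp u 2 volume ∧ seminormSq s u < ∞ := by
  have h1 : Int.fract s = s := Int.fract_eq_self.2 ⟨hs0.le, hs1⟩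
  have h2 : ⌊s⌋₊ = 0 := Nat.floor_eq_zero.2 hs1
  rw [MemSobolev, h1, h2, MemSobolevAux, gagliardoSq_eq_seminormSq]
  simp [hs0]

lemma IsCutoff.memLp_mul {η : EuclideanSpace ℝ (Fin N) → ℝ} {B : ℝ} (hη : IsCutoff η B)
    {u : EuclideanSpace ℝ (Fin N) → ℝ} (hu : MemLp u 2 volume) :
    MemLp (fun x => η x * u x) 2 volume :=
  MemLp.mul (p := ∞) (q := 2) hu
    (memLp_top_of_bound hη.continuous.aestronglyMeasurable B (.of_forall hη.abs_le))

lemma IsCutoff.memSobolev_mul (hN : 1 ≤ N) {s : ℝ} (hs0 : 0 < s) (hs1 : s < 1)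
    {η : EuclideanSpace ℝ (Fin N) → ℝ} {B : ℝ} (hη : IsCutoff η B)
    {u : EuclideanSpace ℝ (Fin N) → ℝ} (hu : MemSobolev s u) :
    MemSobolev s (fun x => η x * u x) := by
  rw [memSobolev_iff hs0 hs1] at hu ⊢
  refine ⟨hη.memLp_mul hu.1, (hη.seminormSq_mul_le hN hs0 hs1 hu.1.1).trans_lt ?_⟩
  have := (memLp_two_iff.1 hu.1).2
  have := hu.2
  finiteness

end

/-! ### The energy form: uniqueness and existence -/

section

variable {N : ℕ}

/-- The weighted difference `(u(x) - u(y)) |x - y|^{-(N+2s)/2}`. -/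
noncomputable def gagGrad (s : ℝ) (u : EuclideanSpace ℝ (Fin N) → ℝ)
    (z : EuclideanSpace ℝ (Fin N) × EuclideanSpace ℝ (Fin N)) : ℝ :=
  (u z.1 - u z.2) * √(fracKer s (z.1 - z.2))

lemma gagGrad_mul_gagGrad (s : ℝ) (u v : EuclideanSpace ℝ (Fin N) → ℝ)
    (z : EuclideanSpace ℝ (Fin N) × EuclideanSpace ℝ (Fin N)) :
    gagGrad s u z * gagGrad s v z =
      (u z.1 - u z.2) * (v z.1 - v z.2) * fracKer s (z.1 - z.2) := by
  rw [gagGrad, gagGrad, mul_mul_mul_comm, Real.mul_self_sqrt (fracKer_nonneg _ _)]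

lemma gagGrad_add (s : ℝ) (u v : EuclideanSpace ℝ (Fin N) → ℝ) :
    gagGrad s (u + v) = gagGrad s u + gagGrad s v := by
  ext z; simp [gagGrad]; ring

lemma gagGrad_sub (s : ℝ) (u v : EuclideanSpace ℝ (Fin N) → ℝ) :
    gagGrad s (u - v) = gagGrad s u - gagGrad s v := by
  ext z; simp [gagGrad]; ring

lemma gagGrad_smul (s c : ℝ) (u : EuclideanSpace ℝ (Fin N) → ℝ) :
    gagGrad s (c • u) = c • gagGrad s u := by
  ext z; simp [gagGrad]; ring

lemma gagGrad_congr_ae {s : ℝ} {u v : EuclideanSpace ℝ (Fin N) → ℝ} (h : u =ᵐ[volume] v) :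
    gagGrad s u =ᵐ[volume] gagGrad s v := by
  filter_upwards [ae_prod_of_ae h] with z hz
  simp only [gagGrad, hz.1, hz.2]

lemma aestronglyMeasurable_gagGrad (s : ℝ) {u : EuclideanSpace ℝ (Fin N) → ℝ}
    (hu : AEStronglyMeasurable u volume) : AEStronglyMeasurable (gagGrad s u) volume := by
  rw [Measure.volume_eq_prod]
  have h1 : Measurable fun z : EuclideanSpace ℝ (Fin N) × EuclideanSpace ℝ (Fin N) =>
      √(fracKer s (z.1 - z.2)) := by fun_prop
  exact (hu.comp_fst.sub hu.comp_snd).mul h1.aestronglyMeasurable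

lemma lintegral_gagGrad_sq (s : ℝ) (u : EuclideanSpace ℝ (Fin N) → ℝ) :
    ∫⁻ z, ‖gagGrad s u z‖ₑ ^ 2 = seminormSq s u := by
  unfold seminormSq
  congr 1; ext z
  have := fracKer_nonneg s (z.1 - z.2)
  rw [enorm_sq_eq_ofReal, enorm_sq_eq_ofReal, ← ENNReal.ofReal_mul (by positivity)]
  simp only [Real.norm_eq_abs, sq_abs]
  rw [gagGrad, mul_pow, Real.sq_sqrt this]

lemma memLp_gagGrad_iff {s : ℝ} {u : EuclideanSpace ℝ (Fin N) → ℝ}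
    (hu : AEStronglyMeasurable u volume) :
    MemLp (gagGrad s u) 2 volume ↔ seminormSq s u < ∞ := by
  rw [memLp_two_iff, lintegral_gagGrad_sq, and_iff_right (aestronglyMeasurable_gagGrad s hu)]

lemma energyForm_eq (s : ℝ) (u v : EuclideanSpace ℝ (Fin N) → ℝ) :
    energyForm s u v = fracLapConst N s / 2 * ∫ z, gagGrad s u z * gagGrad s v z := by
  rw [energyForm]
  congr 2; ext z
  rw [gagGrad_mul_gagGrad, fracKer, div_eq_mul_inv]

lemma memSobolev_iff_memLp {s : ℝ} (hs0 : 0 < s) (hs1 : s < 1)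
    {u : EuclideanSpace ℝ (Fin N) → ℝ} :
    MemSobolev s u ↔ MemLp u 2 volume ∧ MemLp (gagGrad s u) 2 volume := by
  rw [memSobolev_iff hs0 hs1]
  exact and_congr_right fun h => (memLp_gagGrad_iff h.1).symm

lemma energyForm_sub_left {s : ℝ} {u₁ u₂ v : EuclideanSpace ℝ (Fin N) → ℝ}
    (h₁ : MemLp (gagGrad s u₁) 2 volume) (h₂ : MemLp (gagGrad s u₂) 2 volume)
    (hv : MemLp (gagGrad s v) 2 volume) :
    energyForm s (u₁ - u₂) v = energyForm s u₁ v - energyForm s u₂ v := by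
  have h := integral_sub (h₁.integrable_mul hv) (h₂.integrable_mul hv)
  simp only [Pi.mul_apply] at h
  rw [energyForm_eq, energyForm_eq, energyForm_eq, ← mul_sub, ← h, gagGrad_sub]
  simp only [Pi.sub_apply, sub_mul]

variable {Ω : TopologicalSpace.Opens (EuclideanSpace ℝ (Fin N))}

/-- The difference of two solutions is tested against itself: its energy is zero, hence so is its
seminorm, and Poincaré makes it vanish. -/
lemma weakSolution_unique (hN : 1 ≤ N) {s : ℝ} (hs0 : 0 < s) (hs1 : s < 1)
    (hΩ : Bornology.IsBounded (Ω : Set (EuclideanSpace ℝ (Fin N))))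
    {f u₁ u₂ : EuclideanSpace ℝ (Fin N) → ℝ} (h₁ : IsWeakSolution s Ω f u₁)
    (h₂ : IsWeakSolution s Ω f u₂) : u₁ =ᵐ[volume] u₂ := by
  obtain ⟨a1, b1⟩ := (memSobolev_iff_memLp hs0 hs1).1 h₁.1.1
  obtain ⟨a2, b2⟩ := (memSobolev_iff_memLp hs0 hs1).1 h₂.1.1
  have hw : MemLp (gagGrad s (u₁ - u₂)) 2 volume := gagGrad_sub s u₁ u₂ ▸ b1.sub b2
  have hw0 : ∀ᵐ x, x ∉ Ω → (u₁ - u₂) x = 0 := by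
    filter_upwards [h₁.1.2, h₂.1.2] with x e1 e2 hx
    simp [e1 hx, e2 hx]
  have hwm : MemSobolevZero s Ω (u₁ - u₂) :=
    ⟨(memSobolev_iff_memLp hs0 hs1).2 ⟨a1.sub a2, hw⟩, hw0⟩
  have hE : energyForm s (u₁ - u₂) (u₁ - u₂) = 0 := by
    rw [energyForm_sub_left b1 b2 hw, h₁.2 _ hwm, h₂.2 _ hwm, sub_self]
  rw [energyForm_eq, mul_eq_zero, or_iff_right (by have := fracLapConst_pos hN hs0 hs1; positivity),
    integral_eq_zero_iff_of_nonneg (fun z => mul_self_nonneg _) (hw.integrable_mul hw)] at hE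
  have h0 : seminormSq s (u₁ - u₂) = 0 := by
    rw [← lintegral_gagGrad_sq]
    refine (lintegral_congr_ae ?_).trans lintegral_zero
    filter_upwards [hE] with z hz
    simpa using hz
  obtain ⟨C, -, hC⟩ := exists_poincare (F := ℝ) hN hs0 hΩ
  have h3 := hC _ (a1.sub a2).1 hw0
  rw [h0, mul_zero, nonpos_iff_eq_zero,
    lintegral_eq_zero_iff' ((a1.sub a2).1.enorm.pow_const 2)] at h3
  filter_upwards [h3] with x hx
  simpa [sub_eq_zero] using hx

/-- The space `W₀^{s,2}(Ω̄)` as a subspace of `L²(ℝ^N)`. -/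
noncomputable def zeroSpace (s : ℝ) (Ω : TopologicalSpace.Opens (EuclideanSpace ℝ (Fin N))) :
    Submodule ℝ (Lp ℝ 2 (volume : Measure (EuclideanSpace ℝ (Fin N)))) where
  carrier := {u | MemLp (gagGrad s u) 2 volume ∧ ∀ᵐ x, x ∉ Ω → u x = 0}
  zero_mem' := by
    refine ⟨?_, ?_⟩
    · refine (memLp_congr_ae (gagGrad_congr_ae (Lp.coeFn_zero ℝ 2 volume))).2 ?_
      have : gagGrad s (0 : EuclideanSpace ℝ (Fin N) → ℝ) = 0 := by ext; simp [gagGrad]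
      exact this ▸ MemLp.zero
    · filter_upwards [Lp.coeFn_zero ℝ 2 (volume : Measure (EuclideanSpace ℝ (Fin N)))] with x hx _
      exact hx
  add_mem' := by
    rintro u v ⟨hu, hu0⟩ ⟨hv, hv0⟩
    refine ⟨?_, ?_⟩
    · refine (memLp_congr_ae (gagGrad_congr_ae (Lp.coeFn_add u v))).2 ?_
      exact gagGrad_add s u v ▸ hu.add hv
    · filter_upwards [Lp.coeFn_add u v, hu0, hv0] with x hx h1 h2 h3
      exact hx.trans (by simp [h1 h3, h2 h3])
  smul_mem' := by
    rintro c u ⟨hu, hu0⟩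
    refine ⟨?_, ?_⟩
    · refine (memLp_congr_ae (gagGrad_congr_ae (Lp.coeFn_smul c u))).2 ?_
      exact gagGrad_smul s c u ▸ hu.const_smul c
    · filter_upwards [Lp.coeFn_smul c u, hu0] with x hx h1 h3
      simp [hx, h1 h3]

/-- The operator `gagGrad` from `W₀^{s,2}(Ω̄)` to `L²(ℝ^N × ℝ^N)`. -/
noncomputable def gagGradₗ (s : ℝ) (Ω : TopologicalSpace.Opens (EuclideanSpace ℝ (Fin N))) :
    zeroSpace s Ω →ₗ[ℝ]
      Lp ℝ 2 (volume : Measure (EuclideanSpace ℝ (Fin N) × EuclideanSpace ℝ (Fin N))) where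
  toFun u := u.2.1.toLp
  map_add' u v := by
    rw [← MemLp.toLp_add, MemLp.toLp_eq_toLp_iff, ← gagGrad_add]
    exact gagGrad_congr_ae (Lp.coeFn_add _ _)
  map_smul' c u := by
    rw [RingHom.id_apply, ← MemLp.toLp_const_smul, MemLp.toLp_eq_toLp_iff, ← gagGrad_smul]
    exact gagGrad_congr_ae (Lp.coeFn_smul _ _)

lemma coeFn_gagGradₗ (s : ℝ) (u : zeroSpace s Ω) :
    gagGradₗ s Ω u =ᵐ[volume] gagGrad s (u : Lp ℝ 2 (volume : Measure (EuclideanSpace ℝ (Fin N)))) :=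
  MemLp.coeFn_toLp u.2.1

lemma exists_norm_le_gagGradₗ (hN : 1 ≤ N) {s : ℝ} (hs : 0 < s)
    (hΩ : Bornology.IsBounded (Ω : Set (EuclideanSpace ℝ (Fin N)))) :
    ∃ C : ℝ, 0 ≤ C ∧ ∀ u : zeroSpace s Ω, ‖u‖ ≤ C * ‖gagGradₗ s Ω u‖ := by
  obtain ⟨C, hCtop, hC⟩ := exists_poincare (F := ℝ) hN hs hΩ
  refine ⟨√C.toReal, Real.sqrt_nonneg _, fun u => ?_⟩
  have h := hC u.1 (Lp.memLp u.1).1 u.2.2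
  have h' : seminormSq s (u : Lp ℝ 2 (volume : Measure (EuclideanSpace ℝ (Fin N)))) =
      ∫⁻ z, ‖gagGradₗ s Ω u z‖ₑ ^ 2 := by
    rw [← lintegral_gagGrad_sq]
    refine lintegral_congr_ae ?_
    filter_upwards [coeFn_gagGradₗ s u] with z hz
    rw [hz]
  rw [h', lintegral_enorm_sq_eq, lintegral_enorm_sq_eq, ← Lp.enorm_def, ← Lp.enorm_def] at h
  have h2 : ‖u‖ ^ 2 ≤ C.toReal * ‖gagGradₗ s Ω u‖ ^ 2 := by
    have := ENNReal.toReal_mono (by finiteness) h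
    simpa using this
  rw [← Real.sqrt_sq (norm_nonneg u), ← Real.sqrt_sq (norm_nonneg (gagGradₗ s Ω u)),
    ← Real.sqrt_mul ENNReal.toReal_nonneg]
  exact Real.sqrt_le_sqrt h2

/-- By Poincaré, preimages of a convergent sequence are Cauchy in `L²`. Weighted differences pass to
limits pointwise, so the `L²` limit of the preimages is mapped to the limit of the images. -/
lemma isClosed_range_gagGradₗ (hN : 1 ≤ N) {s : ℝ} (hs : 0 < s)
    (hΩ : Bornology.IsBounded (Ω : Set (EuclideanSpace ℝ (Fin N)))) :
    IsClosed ((gagGradₗ s Ω).range :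
      Set (Lp ℝ 2 (volume : Measure (EuclideanSpace ℝ (Fin N) × EuclideanSpace ℝ (Fin N))))) := by
  obtain ⟨C, hC0, hC⟩ := exists_norm_le_gagGradₗ (Ω := Ω) hN hs hΩ
  refine IsSeqClosed.isClosed fun F G hF hG => ?_
  choose u hu using hF
  have hcau : CauchySeq fun n => (u n : Lp ℝ 2 (volume : Measure (EuclideanSpace ℝ (Fin N)))) := by
    have h1 := hG.cauchySeq
    rw [Metric.cauchySeq_iff] at h1 ⊢
    intro ε hε
    obtain ⟨n₀, hn₀⟩ := h1 (ε / (C + 1)) (by positivity)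
    refine ⟨n₀, fun m hm n hn => ?_⟩
    have h2 := hn₀ m hm n hn
    rw [← hu, ← hu, dist_eq_norm, ← map_sub, lt_div_iff₀ (by positivity)] at h2
    rw [dist_eq_norm]
    calc ‖(u m : Lp ℝ 2 (volume : Measure (EuclideanSpace ℝ (Fin N)))) - u n‖ = ‖u m - u n‖ := rfl
      _ ≤ C * ‖gagGradₗ s Ω (u m - u n)‖ := hC _
      _ ≤ ‖gagGradₗ s Ω (u m - u n)‖ * (C + 1) := by nlinarith [norm_nonneg (gagGradₗ s Ω (u m - u n))]
      _ < ε := h2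
  obtain ⟨v, hv⟩ := cauchySeq_tendsto_of_complete hcau
  -- Two successive subsequences: along the first `u n` converges a.e. to `v`, along the second the
  -- weighted differences also converge a.e. to `G`.
  obtain ⟨φ, hφ, hφv⟩ := (tendstoInMeasure_of_tendsto_Lp hv).exists_seq_tendsto_ae
  obtain ⟨ψ, hψ, hψG⟩ := (tendstoInMeasure_of_tendsto_Lp
    (hG.comp hφ.tendsto_atTop)).exists_seq_tendsto_ae
  have hgrad : gagGrad s v =ᵐ[volume] G := by
    have h1 : ∀ᵐ z, ∀ n, F n z = gagGrad s (u n : Lp ℝ 2 (volume : Measure (EuclideanSpace ℝ (Fin N)))) z :=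
      ae_all_iff.2 fun n => hu n ▸ coeFn_gagGradₗ s (u n)
    filter_upwards [h1, ae_prod_of_ae hφv, hψG] with z e1 e2 e3
    refine tendsto_nhds_unique ?_ e3
    simp only [Function.comp_apply, e1]
    exact ((e2.1.comp hψ.tendsto_atTop).sub (e2.2.comp hψ.tendsto_atTop)).mul_const _
  refine ⟨⟨v, (memLp_congr_ae hgrad).2 (Lp.memLp G), ?_⟩, ?_⟩
  · filter_upwards [ae_all_iff.2 fun n => (u n).2.2, hφv] with x h1 h2 hx
    refine tendsto_nhds_unique h2 ?_
    simp only [h1 _ hx]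
    exact tendsto_const_nhds
  · exact Lp.ext ((coeFn_gagGradₗ s _).trans hgrad)

/-- Riesz is applied on the range of `gagGradₗ`, a closed subspace of `L²(ℝ^N × ℝ^N)`, so
`W₀^{s,2}(Ω̄)` needs no Hilbert structure of its own. Poincaré makes the functional `v ↦ ⟨g, v⟩`
continuous in terms of the image of `v`. -/
lemma exists_inner_gagGradₗ_eq (hN : 1 ≤ N) {s : ℝ} (hs : 0 < s)
    (hΩ : Bornology.IsBounded (Ω : Set (EuclideanSpace ℝ (Fin N))))
    (g : Lp ℝ 2 (volume : Measure (EuclideanSpace ℝ (Fin N)))) :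
    ∃ u : zeroSpace s Ω, ∀ v : zeroSpace s Ω, inner ℝ (gagGradₗ s Ω u) (gagGradₗ s Ω v) =
      inner ℝ g (v : Lp ℝ 2 (volume : Measure (EuclideanSpace ℝ (Fin N)))) := by
  obtain ⟨C, hC0, hC⟩ := exists_norm_le_gagGradₗ (Ω := Ω) hN hs hΩ
  have hcl := isClosed_range_gagGradₗ (Ω := Ω) hN hs hΩ
  have : CompleteSpace (gagGradₗ s Ω).range := hcl.completeSpace_coe
  have hinj : Function.Injective (gagGradₗ s Ω) := by
    rw [injective_iff_map_eq_zero]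
    intro u hu
    have := hC u
    rw [hu, norm_zero, mul_zero] at this
    exact norm_le_zero_iff.1 this
  let e := LinearEquiv.ofInjective (gagGradₗ s Ω) hinj
  let ℓ : (gagGradₗ s Ω).range →ₗ[ℝ] ℝ :=
    ((innerSL ℝ g).toLinearMap ∘ₗ (zeroSpace s Ω).subtype) ∘ₗ e.symm.toLinearMap
  have hℓe : ∀ u, ℓ (e u) = inner ℝ g (u : Lp ℝ 2 volume) := fun u => by simp [ℓ]
  have hℓ : ∀ F, ‖ℓ F‖ ≤ (‖g‖ * C) * ‖F‖ := by
    intro F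
    obtain ⟨u, rfl⟩ := e.surjective F
    rw [hℓe, mul_assoc]
    refine (norm_inner_le_norm _ _).trans ?_
    exact mul_le_mul_of_nonneg_left (hC u) (norm_nonneg _)
  obtain ⟨F, hF⟩ := (InnerProductSpace.toDual ℝ (gagGradₗ s Ω).range).surjective
    (ℓ.mkContinuous _ hℓ)
  obtain ⟨u, rfl⟩ := e.surjective F
  refine ⟨u, fun v => ?_⟩
  rw [← hℓe]
  exact congrArg (fun T => T (e v)) hF

lemma integral_gagGrad_mul_gagGrad {s : ℝ} (u w : zeroSpace s Ω) :
    ∫ z, gagGrad s (u : Lp ℝ 2 (volume : Measure (EuclideanSpace ℝ (Fin N)))) z *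
      gagGrad s (w : Lp ℝ 2 (volume : Measure (EuclideanSpace ℝ (Fin N)))) z =
      inner ℝ (gagGradₗ s Ω u) (gagGradₗ s Ω w) := by
  rw [L2.inner_def]
  refine integral_congr_ae ?_
  filter_upwards [coeFn_gagGradₗ s u, coeFn_gagGradₗ s w] with z e1 e2
  rw [e1, e2]
  simp [mul_comm]

lemma energyForm_congr_ae {s : ℝ} {u v w : EuclideanSpace ℝ (Fin N) → ℝ} (h : v =ᵐ[volume] w) :
    energyForm s u v = energyForm s u w := by
  rw [energyForm_eq, energyForm_eq]
  congr 1
  refine integral_congr_ae ?_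
  filter_upwards [gagGrad_congr_ae (s := s) h] with z hz
  rw [hz]

lemma exists_weakSolution (hN : 1 ≤ N) {s : ℝ} (hs0 : 0 < s) (hs1 : s < 1)
    (hΩ : Bornology.IsBounded (Ω : Set (EuclideanSpace ℝ (Fin N))))
    {f : EuclideanSpace ℝ (Fin N) → ℝ}
    (hf : MemLp f 2 (volume.restrict (Ω : Set (EuclideanSpace ℝ (Fin N))))) :
    ∃ u, IsWeakSolution s Ω f u := by
  have hm := Ω.isOpen.measurableSet
  have hf' : MemLp ((Ω : Set (EuclideanSpace ℝ (Fin N))).indicator f) 2 volume :=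
    (memLp_indicator_iff_restrict hm).2 hf
  have hc := fracLapConst_pos hN hs0 hs1
  have hc' : fracLapConst N s / 2 ≠ 0 := by positivity
  -- The factor `C_{N,s}/2` of the energy form is absorbed into the right-hand side.
  obtain ⟨u, hu⟩ := exists_inner_gagGradₗ_eq (Ω := Ω) hN hs0 hΩ
    ((fracLapConst N s / 2)⁻¹ • hf'.toLp)
  refine ⟨u, ⟨(memSobolev_iff_memLp hs0 hs1).2 ⟨Lp.memLp _, u.2.1⟩, u.2.2⟩, fun v hv => ?_⟩
  obtain ⟨hv1, hv2⟩ := (memSobolev_iff_memLp hs0 hs1).1 hv.1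
  have hcv := hv1.coeFn_toLp
  let w : zeroSpace s Ω := ⟨hv1.toLp, (memLp_congr_ae (gagGrad_congr_ae hcv)).2 hv2, by
    filter_upwards [hcv, hv.2] with x h1 h2 h3
    rw [h1, h2 h3]⟩
  have hw : energyForm s (u : Lp ℝ 2 (volume : Measure (EuclideanSpace ℝ (Fin N)))) v =
      energyForm s (u : Lp ℝ 2 (volume : Measure (EuclideanSpace ℝ (Fin N))))
        (w : Lp ℝ 2 (volume : Measure (EuclideanSpace ℝ (Fin N)))) :=
    (energyForm_congr_ae hcv).symm
  rw [hw, energyForm_eq, integral_gagGrad_mul_gagGrad, hu, real_inner_smul_left,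
    mul_inv_cancel_left₀ hc', L2.inner_def, ← integral_indicator hm]
  refine integral_congr_ae ?_
  filter_upwards [hcv, hf'.coeFn_toLp] with x e1 e2
  rw [e1, e2]
  by_cases hx : x ∈ (Ω : Set (EuclideanSpace ℝ (Fin N))) <;> simp [hx, mul_comm]

end

/-! ### Translations and Plancherel for the seminorm -/

section

variable {N : ℕ}

/-- The character `ξ ↦ exp(2πi⟨h,ξ⟩)`. -/
noncomputable def expChar (h ξ : EuclideanSpace ℝ (Fin N)) : ℂ := (𝐞 (inner ℝ h ξ) : ℂ)

lemma norm_expChar (h ξ : EuclideanSpace ℝ (Fin N)) : ‖expChar h ξ‖ = 1 := Circle.norm_coe _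

@[fun_prop]
lemma continuous_expChar :
    Continuous fun p : EuclideanSpace ℝ (Fin N) × EuclideanSpace ℝ (Fin N) => expChar p.1 p.2 := by
  unfold expChar
  exact continuous_subtype_val.comp (Real.continuous_fourierChar.comp (by fun_prop))

lemma continuous_expChar_right (h : EuclideanSpace ℝ (Fin N)) : Continuous (expChar h) :=
  continuous_expChar.comp (Continuous.prodMk_right h)

lemma memLp_expChar (h : EuclideanSpace ℝ (Fin N)) : MemLp (expChar h) ∞ volume :=
  memLp_top_of_bound (continuous_expChar_right h).aestronglyMeasurable 1
    (.of_forall fun ξ => (norm_expChar h ξ).le)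

/-- Translation by `h` on `L²`. -/
noncomputable def translate (h : EuclideanSpace ℝ (Fin N))
    (w : Lp ℂ 2 (volume : Measure (EuclideanSpace ℝ (Fin N)))) :
    Lp ℂ 2 (volume : Measure (EuclideanSpace ℝ (Fin N))) :=
  Lp.compMeasurePreserving (fun x => x + h) (measurePreserving_add_right volume h) w

lemma coeFn_translate (h : EuclideanSpace ℝ (Fin N))
    (w : Lp ℂ 2 (volume : Measure (EuclideanSpace ℝ (Fin N)))) :
    translate h w =ᵐ[volume] fun x => w (x + h) :=
  Lp.coeFn_compMeasurePreserving w (measurePreserving_add_right volume h)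

lemma fourier_comp_add (h : EuclideanSpace ℝ (Fin N)) (f : EuclideanSpace ℝ (Fin N) → ℂ)
    (ξ : EuclideanSpace ℝ (Fin N)) :
    𝓕 (fun x => f (x + h)) ξ = expChar h ξ * 𝓕 f ξ :=
  congrFun (VectorFourier.fourierIntegral_comp_add_right 𝐞 volume
    (innerₗ (EuclideanSpace ℝ (Fin N))) f h) ξ

/-- Multiplication by the character `expChar h` on `L²`. -/
noncomputable def mulExpChar (h : EuclideanSpace ℝ (Fin N)) :
    Lp ℂ 2 (volume : Measure (EuclideanSpace ℝ (Fin N))) →L[ℂ]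
      Lp ℂ 2 (volume : Measure (EuclideanSpace ℝ (Fin N))) :=
  (ContinuousLinearMap.mul ℂ ℂ).holderL volume ∞ 2 2 (memLp_expChar h).toLp

lemma coeFn_mulExpChar (h : EuclideanSpace ℝ (Fin N))
    (w : Lp ℂ 2 (volume : Measure (EuclideanSpace ℝ (Fin N)))) :
    mulExpChar h w =ᵐ[volume] fun ξ => expChar h ξ * w ξ := by
  filter_upwards [ContinuousLinearMap.coeFn_holder (r := 2) (ContinuousLinearMap.mul ℂ ℂ)
    (memLp_expChar h).toLp w, (memLp_expChar h).coeFn_toLp] with ξ h1 h2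
  refine h1.trans ?_
  rw [h2]; rfl

/-- Both sides are continuous in `w`, so it suffices to check Schwartz functions, where the integral
formula for the transform is available. -/
lemma fourier_translate (h : EuclideanSpace ℝ (Fin N))
    (w : Lp ℂ 2 (volume : Measure (EuclideanSpace ℝ (Fin N)))) :
    𝓕 (translate h w) = mulExpChar h (𝓕 w) := by
  refine DenseRange.induction_on (p := fun w => 𝓕 (translate h w) = mulExpChar h (𝓕 w))
    (SchwartzMap.denseRange_toLpCLM (F := ℂ) (p := 2) ENNReal.ofNat_ne_top) w
    (isClosed_eq ?_ ?_) fun f => ?_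
  · exact (Lp.fourierTransformₗᵢ _ ℂ).continuous.comp
      (Lp.isometry_compMeasurePreserving (measurePreserving_add_right volume h)).continuous
  · exact (mulExpChar h).continuous.comp (Lp.fourierTransformₗᵢ _ ℂ).continuous
  · rw [SchwartzMap.toLpCLM_apply, SchwartzMap.toLp_fourier_eq]
    have h1 : translate h (f.toLp 2) = (f.compSubConstCLM ℂ (-h)).toLp 2 := by
      refine Lp.ext ?_
      filter_upwards [coeFn_translate h (f.toLp 2),
        (measurePreserving_add_right volume h).quasiMeasurePreserving.ae_eq_comp
          (f.coeFn_toLp 2 volume), (f.compSubConstCLM ℂ (-h)).coeFn_toLp 2 volume] with x e1 e2 e3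
      rw [e1, e3]
      simpa using e2
    rw [h1, SchwartzMap.toLp_fourier_eq]
    refine Lp.ext ?_
    filter_upwards [coeFn_mulExpChar h ((𝓕 f).toLp 2), (𝓕 f).coeFn_toLp 2 volume,
      (𝓕 (f.compSubConstCLM ℂ (-h))).coeFn_toLp 2 volume] with x e1 e2 e3
    have h2 : ⇑(f.compSubConstCLM ℂ (-h)) = fun y => f (y + h) := by ext y; simp
    rw [e1, e2, e3, SchwartzMap.fourier_coe, SchwartzMap.fourier_coe, ← fourier_comp_add, h2]

/-- The Fourier symbol of the squared Gagliardo seminorm. -/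
noncomputable def symbol (σ : ℝ) (ξ : EuclideanSpace ℝ (Fin N)) : ℝ≥0∞ :=
  ∫⁻ h : EuclideanSpace ℝ (Fin N), ENNReal.ofReal (fracKer σ h) * ‖expChar h ξ - 1‖ₑ ^ 2

lemma measurable_symbol_integrand (σ : ℝ) :
    Measurable fun p : EuclideanSpace ℝ (Fin N) × EuclideanSpace ℝ (Fin N) =>
      ENNReal.ofReal (fracKer σ p.1) * ‖expChar p.1 p.2 - 1‖ₑ ^ 2 := by
  have h1 : Measurable fun p : EuclideanSpace ℝ (Fin N) × EuclideanSpace ℝ (Fin N) =>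
      expChar p.1 p.2 := continuous_expChar.measurable
  have h2 : Measurable fun p : EuclideanSpace ℝ (Fin N) × EuclideanSpace ℝ (Fin N) =>
      fracKer σ p.1 := by fun_prop
  fun_prop

lemma measurable_symbol (σ : ℝ) :
    Measurable (symbol σ : EuclideanSpace ℝ (Fin N) → ℝ≥0∞) :=
  (measurable_symbol_integrand σ).lintegral_prod_left'

lemma lintegral_enorm_sq_fourier (w : Lp ℂ 2 (volume : Measure (EuclideanSpace ℝ (Fin N)))) :
    ∫⁻ ξ, ‖(𝓕 w : Lp ℂ 2 (volume : Measure (EuclideanSpace ℝ (Fin N)))) ξ‖ₑ ^ 2 =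
      ∫⁻ x, ‖w x‖ₑ ^ 2 := by
  rw [lintegral_enorm_sq_eq, lintegral_enorm_sq_eq, ← Lp.enorm_def, ← Lp.enorm_def,
    ← ofReal_norm, ← ofReal_norm, Lp.norm_fourier_eq]

lemma lintegral_translate_sub (h : EuclideanSpace ℝ (Fin N))
    (w : Lp ℂ 2 (volume : Measure (EuclideanSpace ℝ (Fin N)))) :
    ∫⁻ x, ‖w (x + h) - w x‖ₑ ^ 2 = ∫⁻ ξ, ‖expChar h ξ - 1‖ₑ ^ 2 *
      ‖(𝓕 w : Lp ℂ 2 (volume : Measure (EuclideanSpace ℝ (Fin N)))) ξ‖ₑ ^ 2 := by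
  calc ∫⁻ x, ‖w (x + h) - w x‖ₑ ^ 2 = ∫⁻ x, ‖(translate h w - w) x‖ₑ ^ 2 := by
        refine lintegral_congr_ae ?_
        filter_upwards [coeFn_translate h w, Lp.coeFn_sub (translate h w) w] with x e1 e2
        rw [e2, Pi.sub_apply, e1]
    _ = ∫⁻ x, ‖(𝓕 (translate h w - w) :
          Lp ℂ 2 (volume : Measure (EuclideanSpace ℝ (Fin N)))) x‖ₑ ^ 2 :=
        (lintegral_enorm_sq_fourier _).symm
    _ = _ := by
        have e0 : 𝓕 (translate h w - w) = mulExpChar h (𝓕 w) - 𝓕 w := by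
          rw [← fourier_translate]
          exact map_sub (Lp.fourierTransformₗᵢ (EuclideanSpace ℝ (Fin N)) ℂ) _ _
        rw [e0]
        refine lintegral_congr_ae ?_
        filter_upwards [coeFn_mulExpChar h (𝓕 w), Lp.coeFn_sub (mulExpChar h (𝓕 w)) (𝓕 w)]
          with x e1 e2
        rw [e2, Pi.sub_apply, e1, ← mul_pow, ← enorm_mul, sub_mul, one_mul]

/-- Plancherel's theorem for the Gagliardo seminorm. -/
lemma seminormSq_eq_lintegral_symbol (σ : ℝ)
    (w : Lp ℂ 2 (volume : Measure (EuclideanSpace ℝ (Fin N)))) :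
    seminormSq σ w = ∫⁻ ξ, symbol σ ξ *
      ‖(𝓕 w : Lp ℂ 2 (volume : Measure (EuclideanSpace ℝ (Fin N)))) ξ‖ₑ ^ 2 := by
  have hm : AEMeasurable (fun ξ => ‖(𝓕 w : Lp ℂ 2 (volume : Measure (EuclideanSpace ℝ (Fin N)))) ξ‖ₑ ^ 2) :=
    (Lp.stronglyMeasurable _).enorm.pow_const 2 |>.aemeasurable
  rw [seminormSq_eq_lintegral_lintegral σ (Lp.memLp w).1]
  simp_rw [lintegral_translate_sub]
  have h1 : ∀ h : EuclideanSpace ℝ (Fin N), ENNReal.ofReal (fracKer σ h) *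
      ∫⁻ ξ, ‖expChar h ξ - 1‖ₑ ^ 2 *
        ‖(𝓕 w : Lp ℂ 2 (volume : Measure (EuclideanSpace ℝ (Fin N)))) ξ‖ₑ ^ 2 =
      ∫⁻ ξ, ENNReal.ofReal (fracKer σ h) * ‖expChar h ξ - 1‖ₑ ^ 2 *
        ‖(𝓕 w : Lp ℂ 2 (volume : Measure (EuclideanSpace ℝ (Fin N)))) ξ‖ₑ ^ 2 := by
    intro h
    rw [← lintegral_const_mul' _ _ ENNReal.ofReal_ne_top]
    simp_rw [mul_assoc]
  simp_rw [h1]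
  rw [lintegral_lintegral_swap ((measurable_symbol_integrand σ).aemeasurable.mul
    hm.comp_snd)]
  congr 1; ext ξ
  rw [lintegral_mul_const' _ _ (by finiteness), symbol]

end

/-! ### The symbol is comparable to `|ξ|^{2σ}` -/

section

variable {N : ℕ}

lemma norm_expChar_sub_one (h ξ : EuclideanSpace ℝ (Fin N)) :
    ‖expChar h ξ - 1‖ = 2 * |Real.sin (Real.pi * inner ℝ h ξ)| := by
  rw [expChar, Real.fourierChar_apply, mul_comm _ Complex.I, Complex.norm_exp_I_mul_ofReal_sub_one,
    norm_mul, Real.norm_eq_abs, Real.norm_eq_abs, abs_two]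
  ring_nf

lemma fracKer_smul (σ : ℝ) {a : ℝ} (ha : 0 < a) (h : EuclideanSpace ℝ (Fin N)) :
    fracKer σ h = a ^ ((N : ℝ) + 2 * σ) * fracKer σ (a • h) := by
  have := Real.rpow_pos_of_pos ha ((N : ℝ) + 2 * σ)
  rw [fracKer, fracKer, norm_smul, Real.norm_of_nonneg ha.le,
    Real.mul_rpow ha.le (norm_nonneg _), mul_inv, mul_inv_cancel_left₀ this.ne']

lemma lintegral_comp_smul_eq {a : ℝ} (ha : 0 < a) {p : EuclideanSpace ℝ (Fin N) → ℝ≥0∞}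
    (hp : Measurable p) : ∫⁻ h, p (a • h) = ENNReal.ofReal ((a ^ N)⁻¹) * ∫⁻ h, p h := by
  rw [← lintegral_map hp (measurable_const_smul a), Measure.map_addHaar_smul volume ha.ne',
    lintegral_smul_measure, finrank_euclideanSpace, Fintype.card_fin, abs_of_pos (by positivity),
    smul_eq_mul]

lemma symbol_zero (σ : ℝ) : symbol σ (0 : EuclideanSpace ℝ (Fin N)) = 0 := by
  simp [symbol, expChar]

/-- Since `|e^{it} - 1| ≤ min(2, |t|)`, the squared factor is at most `4π² min(1, |ξ|²|h|²)`.
Rescaling `h` by `‖ξ‖` and homogeneity of the kernel then extract the power `‖ξ‖^(2σ)` and leave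
`kerMass`. -/
lemma symbol_le (hN : 1 ≤ N) {σ : ℝ} (h0 : 0 < σ) (h1 : σ < 1) (ξ : EuclideanSpace ℝ (Fin N)) :
    symbol σ ξ ≤ ENNReal.ofReal (4 * Real.pi ^ 2 * kerMass N σ * ‖ξ‖ ^ (2 * σ)) := by
  rcases eq_or_ne ξ 0 with rfl | hξ
  · rw [symbol_zero]; exact zero_le
  have ha : 0 < ‖ξ‖ := norm_pos_iff.2 hξ
  have hb : ∀ h, ENNReal.ofReal (fracKer σ h) * ‖expChar h ξ - 1‖ₑ ^ 2 ≤
      ENNReal.ofReal (4 * Real.pi ^ 2 * ‖ξ‖ ^ ((N : ℝ) + 2 * σ)) *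
        (ENNReal.ofReal (min 1 (‖‖ξ‖ • h‖ ^ 2)) * ENNReal.ofReal (fracKer σ (‖ξ‖ • h))) := by
    intro h
    rw [fracKer_smul σ ha h, enorm_sq_eq_ofReal,
      ← ENNReal.ofReal_mul (by have := fracKer_nonneg σ (‖ξ‖ • h); positivity),
      ← ENNReal.ofReal_mul (by positivity), ← ENNReal.ofReal_mul (by positivity)]
    refine ENNReal.ofReal_le_ofReal ?_
    have hk := fracKer_nonneg σ (‖ξ‖ • h)
    have e : ‖expChar h ξ - 1‖ ^ 2 ≤ 4 * Real.pi ^ 2 * min 1 (‖‖ξ‖ • h‖ ^ 2) := by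
      rw [norm_expChar_sub_one, mul_pow, sq_abs, norm_smul, norm_norm]
      rcases le_total 1 ((‖ξ‖ * ‖h‖) ^ 2) with hc | hc
      · rw [min_eq_left hc]
        nlinarith [Real.sin_sq_le_one (Real.pi * inner ℝ h ξ), Real.pi_gt_three]
      · rw [min_eq_right hc]
        have e1 : |Real.sin (Real.pi * inner ℝ h ξ)| ≤ Real.pi * (‖ξ‖ * ‖h‖) := by
          refine Real.abs_sin_le_abs.trans ?_
          rw [abs_mul, abs_of_pos Real.pi_pos, mul_comm ‖ξ‖]
          gcongr
          exact abs_real_inner_le_norm h ξ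
        have e2 := pow_le_pow_left₀ (abs_nonneg _) e1 2
        rw [sq_abs] at e2
        nlinarith
    calc _ ≤ ‖ξ‖ ^ ((N : ℝ) + 2 * σ) * fracKer σ (‖ξ‖ • h) *
          (4 * Real.pi ^ 2 * min 1 (‖‖ξ‖ • h‖ ^ 2)) := by gcongr
      _ = _ := by ring
  refine (lintegral_mono hb).trans ?_
  rw [lintegral_const_mul' _ _ ENNReal.ofReal_ne_top,
    lintegral_comp_smul_eq (p := fun h => ENNReal.ofReal (min 1 (‖h‖ ^ 2)) *
      ENNReal.ofReal (fracKer σ h)) ha (by fun_prop), lintegral_min_mul_fracKer hN h0 h1,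
    ← ENNReal.ofReal_mul (by positivity), ← ENNReal.ofReal_mul (by positivity)]
  refine ENNReal.ofReal_le_ofReal (le_of_eq ?_)
  rw [Real.rpow_add ha, Real.rpow_natCast]
  field_simp

/-- The integral is restricted to a ball of radius `1/(8‖ξ‖)` around a multiple of `ξ` on which the
phase `⟨h, ξ⟩` stays near `1/4`, away from the integers. There the kernel is at least `‖ξ‖^(N+2σ)`,
while the ball has volume proportional to `‖ξ‖^(-N)`. -/
lemma exists_le_symbol (hN : 1 ≤ N) {σ : ℝ} (h0 : 0 < σ) :
    ∃ c : ℝ, 0 < c ∧ ∀ ξ : EuclideanSpace ℝ (Fin N),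
      ENNReal.ofReal (c * ‖ξ‖ ^ (2 * σ)) ≤ symbol σ ξ := by
  have : Nontrivial (EuclideanSpace ℝ (Fin N)) := by
    have : Nonempty (Fin N) := ⟨⟨0, hN⟩⟩
    infer_instance
  set v := volume (Metric.ball (0 : EuclideanSpace ℝ (Fin N)) 1)
  have hv0 : 0 < v.toReal :=
    ENNReal.toReal_pos (Metric.measure_ball_pos _ _ one_pos).ne' measure_ball_lt_top.ne
  refine ⟨((1 / 8) ^ N * v.toReal) / 4, by positivity, fun ξ => ?_⟩
  rcases eq_or_ne ξ 0 with rfl | hξ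
  · rw [norm_zero, Real.zero_rpow (by positivity)]; simp
  have ha : 0 < ‖ξ‖ := norm_pos_iff.2 hξ
  set c : EuclideanSpace ℝ (Fin N) := (1 / (4 * ‖ξ‖ ^ 2)) • ξ
  set r : ℝ := 1 / (8 * ‖ξ‖)
  have hr : 0 < r := by positivity
  have hc : ‖c‖ = 1 / (4 * ‖ξ‖) := by
    rw [norm_smul, Real.norm_of_nonneg (by positivity)]; field_simp
  have hcξ : inner ℝ c ξ = 1 / 4 := by
    rw [real_inner_smul_left, real_inner_self_eq_norm_sq]; field_simp
  have hball : ∀ h ∈ Metric.ball c r, ENNReal.ofReal (‖ξ‖ ^ ((N : ℝ) + 2 * σ) * (1 / 4)) ≤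
      ENNReal.ofReal (fracKer σ h) * ‖expChar h ξ - 1‖ₑ ^ 2 := by
    intro h hh
    have hd : ‖h - c‖ < r := by simpa [dist_eq_norm] using hh
    have hin : |inner ℝ h ξ - 1 / 4| ≤ 1 / 8 := by
      rw [← hcξ, ← inner_sub_left]
      refine (abs_real_inner_le_norm _ _).trans ?_
      calc ‖h - c‖ * ‖ξ‖ ≤ r * ‖ξ‖ := by gcongr
        _ = 1 / 8 := by simp only [r]; field_simp
    obtain ⟨hi1, hi2⟩ := abs_le.1 hin
    have hh0 : 0 < ‖h‖ := by
      rw [norm_pos_iff]; rintro rfl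
      rw [inner_zero_left] at hi1
      linarith
    have hh1 : ‖h‖ ≤ ‖ξ‖⁻¹ := by
      have e1 : ‖h‖ ≤ ‖h - c‖ + ‖c‖ := norm_le_norm_sub_add h c
      have e2 : r + 1 / (4 * ‖ξ‖) ≤ ‖ξ‖⁻¹ := by
        simp only [r]; field_simp; norm_num
      linarith
    have hker : ‖ξ‖ ^ ((N : ℝ) + 2 * σ) ≤ fracKer σ h := by
      rw [fracKer, ← Real.inv_rpow (norm_nonneg _)]
      have : ‖ξ‖ ≤ ‖h‖⁻¹ := (le_inv_comm₀ ha hh0).2 hh1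
      exact Real.rpow_le_rpow ha.le this (by positivity)
    -- As `⟨h, ξ⟩ ∈ [1/8, 3/8]`, Jordan's inequality gives `sin(π⟨h, ξ⟩) ≥ 2⟨h, ξ⟩ ≥ 1/4`, so the
    -- norm is at least `1/2`.
    have hsin : (1 / 4 : ℝ) ≤ ‖expChar h ξ - 1‖ ^ 2 := by
      rw [norm_expChar_sub_one]
      have e := Real.mul_le_sin (x := Real.pi * inner ℝ h ξ)
        (mul_nonneg Real.pi_pos.le (by linarith)) (by nlinarith [Real.pi_pos])
      have e' : 2 / Real.pi * (Real.pi * inner ℝ h ξ) = 2 * inner ℝ h ξ := by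
        field_simp
      have e2 := le_abs_self (Real.sin (Real.pi * inner ℝ h ξ))
      nlinarith
    rw [enorm_sq_eq_ofReal, ← ENNReal.ofReal_mul (fracKer_nonneg σ h)]
    exact ENNReal.ofReal_le_ofReal (mul_le_mul hker hsin (by norm_num) (fracKer_nonneg σ h))
  calc ENNReal.ofReal ((1 / 8) ^ N * v.toReal / 4 * ‖ξ‖ ^ (2 * σ)) =
      ENNReal.ofReal (‖ξ‖ ^ ((N : ℝ) + 2 * σ) * (1 / 4)) * volume (Metric.ball c r) := by
        rw [Measure.addHaar_ball _ _ hr.le, finrank_euclideanSpace, Fintype.card_fin,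
          ← ENNReal.ofReal_toReal (a := volume (Metric.ball (0 : EuclideanSpace ℝ (Fin N)) 1))
            measure_ball_lt_top.ne, ← ENNReal.ofReal_mul (by positivity),
          ← ENNReal.ofReal_mul (by positivity)]
        congr 1
        rw [Real.rpow_add ha, Real.rpow_natCast]
        simp only [r, v, one_div, inv_pow, mul_pow]
        field_simp
    _ = ∫⁻ h in Metric.ball c r, ENNReal.ofReal (‖ξ‖ ^ ((N : ℝ) + 2 * σ) * (1 / 4)) := by
        rw [setLIntegral_const]
    _ ≤ ∫⁻ h in Metric.ball c r, ENNReal.ofReal (fracKer σ h) * ‖expChar h ξ - 1‖ₑ ^ 2 :=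
        setLIntegral_mono' measurableSet_ball hball
    _ ≤ _ := setLIntegral_le_lintegral _ _

end

/-! ### The commutator estimate -/

section

variable {N : ℕ}

lemma abs_integral_mul_le {α : Type*} [MeasurableSpace α] {μ : Measure α} {f g : α → ℝ}
    (hf : MemLp f 2 μ) (hg : MemLp g 2 μ) :
    |∫ x, f x * g x ∂μ| ≤ (eLpNorm f 2 μ).toReal * (eLpNorm g 2 μ).toReal := by
  have h : ∫ x, f x * g x ∂μ = inner ℝ hf.toLp hg.toLp := by
    rw [L2.inner_def]
    refine integral_congr_ae ?_
    filter_upwards [hf.coeFn_toLp, hg.coeFn_toLp] with x e1 e2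
    rw [e1, e2]
    simp [mul_comm]
  rw [h, ← Lp.norm_toLp f hf, ← Lp.norm_toLp g hg]
  exact abs_real_inner_le_norm _ _

lemma integral_abs_mul_le {α : Type*} [MeasurableSpace α] {μ : Measure α} {f g : α → ℝ}
    (hf : MemLp f 2 μ) (hg : MemLp g 2 μ) :
    ∫ x, |f x * g x| ∂μ ≤ (eLpNorm f 2 μ).toReal * (eLpNorm g 2 μ).toReal := by
  rw [← eLpNorm_norm f, ← eLpNorm_norm g]
  refine le_trans (le_trans (le_of_eq ?_) (le_abs_self _)) (abs_integral_mul_le hf.norm hg.norm)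
  simp [abs_mul]

/-- The kernel `|h|^{-(N+2s)}` truncated to `|h| > ε`. -/
noncomputable def truncKer (s ε : ℝ) (h : EuclideanSpace ℝ (Fin N)) : ℝ :=
  if ε < ‖h‖ then fracKer s h else 0

lemma truncKer_nonneg (s ε : ℝ) (h : EuclideanSpace ℝ (Fin N)) : 0 ≤ truncKer s ε h := by
  unfold truncKer; split_ifs; exacts [fracKer_nonneg s h, le_rfl]

lemma truncKer_le (s ε : ℝ) (h : EuclideanSpace ℝ (Fin N)) : truncKer s ε h ≤ fracKer s h := by
  unfold truncKer; split_ifs; exacts [le_rfl, fracKer_nonneg s h]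

lemma truncKer_neg (s ε : ℝ) (h : EuclideanSpace ℝ (Fin N)) :
    truncKer s ε (-h) = truncKer s ε h := by
  simp [truncKer, fracKer_neg]

@[fun_prop]
lemma measurable_truncKer (s ε : ℝ) :
    Measurable (truncKer s ε : EuclideanSpace ℝ (Fin N) → ℝ) :=
  Measurable.ite (measurableSet_lt measurable_const measurable_norm) (measurable_fracKer s)
    measurable_const

lemma sqrt_fracKer_mul_sqrt_truncKer (s ε : ℝ) (h : EuclideanSpace ℝ (Fin N)) :
    √(fracKer s h) * √(truncKer s ε h) = truncKer s ε h := by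
  unfold truncKer
  split_ifs
  · exact Real.mul_self_sqrt (fracKer_nonneg s h)
  · simp

lemma truncKer_le_min_mul (s : ℝ) {ε : ℝ} (hε : 0 < ε) (h : EuclideanSpace ℝ (Fin N)) :
    truncKer s ε h ≤ (1 + (ε ^ 2)⁻¹) * (min 1 (‖h‖ ^ 2) * fracKer s h) := by
  have hk := fracKer_nonneg s h
  unfold truncKer
  split_ifs with hh
  · rw [← mul_assoc]
    refine le_mul_of_one_le_left hk ?_
    rcases le_total 1 (‖h‖ ^ 2) with hc | hc
    · rw [min_eq_left hc, mul_one, le_add_iff_nonneg_right]; positivity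
    · rw [min_eq_right hc, add_mul]
      have h1 : ε ^ 2 ≤ ‖h‖ ^ 2 := pow_le_pow_left₀ hε.le hh.le 2
      have h2 : 1 ≤ (ε ^ 2)⁻¹ * ‖h‖ ^ 2 := by
        rw [inv_mul_eq_div, one_le_div (by positivity)]; exact h1
      nlinarith [sq_nonneg ‖h‖]
  · positivity

lemma integrable_truncKer (hN : 1 ≤ N) {s ε : ℝ} (hs0 : 0 < s) (hs1 : s < 1) (hε : 0 < ε) :
    Integrable (truncKer s ε : EuclideanSpace ℝ (Fin N) → ℝ) := by
  refine ((integrable_min_mul_fracKer hN hs0 hs1).const_mul (1 + (ε ^ 2)⁻¹)).mono'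
    (measurable_truncKer s ε).aestronglyMeasurable (.of_forall fun h => ?_)
  rw [Real.norm_of_nonneg (truncKer_nonneg s ε h)]
  exact truncKer_le_min_mul s hε h

lemma integrable_snd_mul_fracKer (hN : 1 ≤ N) {s : ℝ} (hs0 : 0 < s) (hs1 : s < 1)
    {p : EuclideanSpace ℝ (Fin N) → ℝ} (hp : Integrable p) :
    Integrable (fun z : EuclideanSpace ℝ (Fin N) × EuclideanSpace ℝ (Fin N) =>
      p z.2 * (min 1 (‖z.1 - z.2‖ ^ 2) * fracKer s (z.1 - z.2))) := by
  have hk : Measurable fun z : EuclideanSpace ℝ (Fin N) × EuclideanSpace ℝ (Fin N) =>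
      min 1 (‖z.1 - z.2‖ ^ 2) * fracKer s (z.1 - z.2) := by fun_prop
  refine ⟨?_, ?_⟩
  · rw [Measure.volume_eq_prod]
    exact hp.1.comp_snd.mul hk.aestronglyMeasurable
  · have h1 : ∀ z : EuclideanSpace ℝ (Fin N) × EuclideanSpace ℝ (Fin N),
        ‖p z.2 * (min 1 (‖z.1 - z.2‖ ^ 2) * fracKer s (z.1 - z.2))‖ₑ = ‖p z.2‖ₑ *
          (ENNReal.ofReal (min 1 (‖z.1 - z.2‖ ^ 2)) * ENNReal.ofReal (fracKer s (z.1 - z.2))) := by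
      intro z
      rw [enorm_mul, Real.enorm_of_nonneg (mul_nonneg (by positivity) (fracKer_nonneg _ _)),
        ENNReal.ofReal_mul (by positivity)]
    rw [HasFiniteIntegral]
    simp_rw [h1]
    rw [lintegral_snd_mul_fracKer hN hs0 hs1 hp.1.enorm]
    have : ∫⁻ x, ‖p x‖ₑ < ∞ := hp.2
    finiteness

lemma integrable_fst_mul_fracKer (hN : 1 ≤ N) {s : ℝ} (hs0 : 0 < s) (hs1 : s < 1)
    {p : EuclideanSpace ℝ (Fin N) → ℝ} (hp : Integrable p) :
    Integrable (fun z : EuclideanSpace ℝ (Fin N) × EuclideanSpace ℝ (Fin N) =>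
      p z.1 * (min 1 (‖z.1 - z.2‖ ^ 2) * fracKer s (z.1 - z.2))) := by
  have h := integrable_snd_mul_fracKer hN hs0 hs1 hp
  rw [Measure.volume_eq_prod] at h ⊢
  refine h.swap.congr (.of_forall fun z => ?_)
  simp [norm_sub_rev z.2 z.1, fracKer_sub_comm s z.2 z.1]

variable {η u φ : EuclideanSpace ℝ (Fin N) → ℝ} {B s ε : ℝ}

lemma IsCutoff.abs_sub_le (hη : IsCutoff η B) (x y : EuclideanSpace ℝ (Fin N)) :
    |η x - η y| ≤ 2 * B := by
  have h1 := _root_.abs_le.1 (hη.abs_le x)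
  have h2 := _root_.abs_le.1 (hη.abs_le y)
  rw [_root_.abs_le]; constructor <;> linarith

/-- The truncated kernel is even, so averaging the substitutions `y = x + h` and `y = x - h`
produces half a second difference of `η`. That is `O(|h|²)`, hence the bound does not depend on `ε`;
first differences alone would not suffice when `s ≥ 1/2`. -/
lemma IsCutoff.abs_integral_sub_mul_truncKer_le (hN : 1 ≤ N) (hs0 : 0 < s) (hs1 : s < 1)
    (hε : 0 < ε) (hη : IsCutoff η B) (x : EuclideanSpace ℝ (Fin N)) :
    |∫ y, (η x - η y) * truncKer s ε (x - y)| ≤ B / 2 * kerMass N s := by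
  have hc := hη.continuous
  have hk := integrable_truncKer hN hs0 hs1 hε
  have e1 : ∫ y, (η x - η y) * truncKer s ε (x - y) =
      ∫ h, (η x - η (x + h)) * truncKer s ε h := by
    rw [← integral_add_left_eq_self _ x]
    simp [truncKer_neg]
  have e2 : ∫ y, (η x - η y) * truncKer s ε (x - y) =
      ∫ h, (η x - η (x - h)) * truncKer s ε h := by
    rw [← integral_sub_left_eq_self _ volume x]
    simp
  have i1 : Integrable fun h => (η x - η (x + h)) * truncKer s ε h :=
    hk.bdd_mul (by fun_prop) (.of_forall fun h => hη.abs_sub_le x (x + h))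
  have i2 : Integrable fun h => (η x - η (x - h)) * truncKer s ε h :=
    hk.bdd_mul (by fun_prop) (.of_forall fun h => hη.abs_sub_le x (x - h))
  have e3 : 2 * ∫ y, (η x - η y) * truncKer s ε (x - y) =
      ∫ h, (2 * η x - η (x + h) - η (x - h)) * truncKer s ε h := by
    rw [two_mul]
    nth_rewrite 1 [e1]
    rw [e2, ← integral_add i1 i2]
    congr 1; ext h; ring
  have e4 := norm_integral_le_of_norm_le
    ((integrable_min_mul_fracKer (N := N) hN hs0 hs1).const_mul B)
    (f := fun h => (2 * η x - η (x + h) - η (x - h)) * truncKer s ε h)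
    (.of_forall fun h => by
      rw [norm_mul, Real.norm_of_nonneg (truncKer_nonneg s ε h), ← mul_assoc]
      exact mul_le_mul (hη.second_diff_le x h) (truncKer_le s ε h) (truncKer_nonneg s ε h)
        (mul_nonneg hη.nonneg (by positivity)))
  rw [← e3, integral_const_mul, Real.norm_eq_abs, abs_mul, abs_two] at e4
  change _ ≤ B * kerMass N s at e4
  linarith

lemma IsCutoff.integrable_cross (hN : 1 ≤ N) (hs0 : 0 < s) (hs1 : s < 1) (hε : 0 < ε)
    (hη : IsCutoff η B) (hu : MemLp u 2 volume) (hφ : MemLp φ 2 volume) :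
    Integrable fun z : EuclideanSpace ℝ (Fin N) × EuclideanSpace ℝ (Fin N) =>
      (η z.1 - η z.2) * (u z.2 * φ z.1) * truncKer s ε (z.1 - z.2) := by
  have hc := hη.continuous
  have hB := hη.nonneg
  refine (((integrable_snd_mul_fracKer hN hs0 hs1 hu.integrable_sq).add
    (integrable_fst_mul_fracKer hN hs0 hs1 hφ.integrable_sq)).const_mul
      (B * (1 + (ε ^ 2)⁻¹))).mono' ?_ (.of_forall fun z => ?_)
  · have h1 : Measurable fun z : EuclideanSpace ℝ (Fin N) × EuclideanSpace ℝ (Fin N) =>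
        truncKer s ε (z.1 - z.2) := by fun_prop
    have h2 : Continuous fun z : EuclideanSpace ℝ (Fin N) × EuclideanSpace ℝ (Fin N) =>
        η z.1 - η z.2 := by fun_prop
    rw [Measure.volume_eq_prod]
    exact (h2.aestronglyMeasurable.mul (hu.1.comp_snd.mul hφ.1.comp_fst)).mul
      h1.aestronglyMeasurable
  · have hk := truncKer_nonneg s ε (z.1 - z.2)
    have h1 : |u z.2 * φ z.1| ≤ (u z.2 ^ 2 + φ z.1 ^ 2) / 2 := by
      rw [_root_.abs_le]
      constructor <;> nlinarith [sq_nonneg (u z.2 - φ z.1), sq_nonneg (u z.2 + φ z.1)]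
    rw [norm_mul, norm_mul, Real.norm_of_nonneg hk]
    calc ‖η z.1 - η z.2‖ * ‖u z.2 * φ z.1‖ * truncKer s ε (z.1 - z.2)
        ≤ (2 * B) * ((u z.2 ^ 2 + φ z.1 ^ 2) / 2) * ((1 + (ε ^ 2)⁻¹) *
          (min 1 (‖z.1 - z.2‖ ^ 2) * fracKer s (z.1 - z.2))) := by
          gcongr
          · exact hη.abs_sub_le _ _
          · exact h1
          · exact truncKer_le_min_mul s hε _
      _ = _ := by simp only [Pi.add_apply]; ring

/-- The squared difference of `η` supplies `min 1 |x - y|²`, so the bound is uniform in `ε`. This is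
the factor paired with `gagGrad s u` by Cauchy–Schwarz. -/
lemma IsCutoff.memLp_weight (hN : 1 ≤ N) (hs0 : 0 < s) (hs1 : s < 1)
    (hη : IsCutoff η B) (hφ : MemLp φ 2 volume) :
    MemLp (fun z : EuclideanSpace ℝ (Fin N) × EuclideanSpace ℝ (Fin N) =>
      φ z.1 * (η z.1 - η z.2) * √(truncKer s ε (z.1 - z.2))) 2 volume ∧
    (eLpNorm (fun z : EuclideanSpace ℝ (Fin N) × EuclideanSpace ℝ (Fin N) =>
      φ z.1 * (η z.1 - η z.2) * √(truncKer s ε (z.1 - z.2))) 2 volume).toReal ≤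
      √(B * kerMass N s) * (eLpNorm φ 2 volume).toReal := by
  have hc := hη.continuous
  have hB := hη.nonneg
  have hK := kerMass_nonneg (N := N) s
  have hm : AEStronglyMeasurable (fun z : EuclideanSpace ℝ (Fin N) × EuclideanSpace ℝ (Fin N) =>
      φ z.1 * (η z.1 - η z.2) * √(truncKer s ε (z.1 - z.2))) volume := by
    have h1 : Measurable fun z : EuclideanSpace ℝ (Fin N) × EuclideanSpace ℝ (Fin N) =>
        √(truncKer s ε (z.1 - z.2)) := by fun_prop
    have h2 : Continuous fun z : EuclideanSpace ℝ (Fin N) × EuclideanSpace ℝ (Fin N) =>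
        η z.1 - η z.2 := by fun_prop
    rw [Measure.volume_eq_prod]
    exact (hφ.1.comp_fst.mul h2.aestronglyMeasurable).mul h1.aestronglyMeasurable
  have hle : ∫⁻ z : EuclideanSpace ℝ (Fin N) × EuclideanSpace ℝ (Fin N),
      ‖φ z.1 * (η z.1 - η z.2) * √(truncKer s ε (z.1 - z.2))‖ₑ ^ 2 ≤
      ENNReal.ofReal (B * kerMass N s) * ∫⁻ x, ‖φ x‖ₑ ^ 2 := by
    rw [ENNReal.ofReal_mul hB, mul_assoc, mul_comm (ENNReal.ofReal (kerMass N s)),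
      ← lintegral_fst_mul_fracKer hN hs0 hs1 (hφ.1.enorm.pow_const 2),
      ← lintegral_const_mul' _ _ ENNReal.ofReal_ne_top]
    refine lintegral_mono fun z => ?_
    have hk := fracKer_nonneg s (z.1 - z.2)
    simp only [enorm_sq_eq_ofReal, Real.norm_eq_abs, sq_abs]
    rw [← ENNReal.ofReal_mul (by positivity), ← ENNReal.ofReal_mul (by positivity),
      ← ENNReal.ofReal_mul (by positivity)]
    refine ENNReal.ofReal_le_ofReal ?_
    rw [mul_pow, mul_pow, Real.sq_sqrt (truncKer_nonneg _ _ _)]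
    calc φ z.1 ^ 2 * (η z.1 - η z.2) ^ 2 * truncKer s ε (z.1 - z.2)
        ≤ φ z.1 ^ 2 * (B * min 1 (‖z.1 - z.2‖ ^ 2)) * fracKer s (z.1 - z.2) := by
          gcongr
          · exact truncKer_nonneg _ _ _
          · exact hη.sq_sub_le _ _
          · exact truncKer_le _ _ _
      _ = _ := by ring
  have hfin := (memLp_two_iff.1 hφ).2
  refine ⟨memLp_two_iff.2 ⟨hm, hle.trans_lt (by finiteness)⟩, ?_⟩
  rw [lintegral_enorm_sq_eq, lintegral_enorm_sq_eq] at hle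
  have h3 := ENNReal.toReal_mono (by have := hφ.2.ne; finiteness) hle
  rw [ENNReal.toReal_mul, ENNReal.toReal_pow, ENNReal.toReal_pow,
    ENNReal.toReal_ofReal (by positivity)] at h3
  refine (Real.le_sqrt_of_sq_le h3).trans (le_of_eq ?_)
  rw [Real.sqrt_mul (by positivity), Real.sqrt_sq ENNReal.toReal_nonneg]

/-- The bound for the truncated commutator. -/
lemma IsCutoff.abs_integral_cross_le (hN : 1 ≤ N) (hs0 : 0 < s) (hs1 : s < 1) (hε : 0 < ε)
    (hη : IsCutoff η B) (hu : MemLp u 2 volume) (hu' : MemLp (gagGrad s u) 2 volume)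
    (hφ : MemLp φ 2 volume) :
    |∫ z : EuclideanSpace ℝ (Fin N) × EuclideanSpace ℝ (Fin N),
      (η z.1 - η z.2) * (u z.2 * φ z.1) * truncKer s ε (z.1 - z.2)| ≤
      (B / 2 * kerMass N s * (eLpNorm u 2 volume).toReal +
        (eLpNorm (gagGrad s u) 2 volume).toReal * √(B * kerMass N s)) *
        (eLpNorm φ 2 volume).toReal := by
  have hP := hη.integrable_cross hN hs0 hs1 hε hu hφ
  obtain ⟨hw, hw'⟩ := hη.memLp_weight (ε := ε) hN hs0 hs1 hφ
  have hS := hu'.integrable_mul hw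
  have hB := hη.nonneg
  have hK := kerMass_nonneg (N := N) s
  -- Writing `u(y) = u(x) - (u(x) - u(y))` splits the integral. With `u(x)` the `y`-integration
  -- meets only `η`, so the second-difference bound applies; the rest is a pairing of `gagGrad s u`
  -- with the weight.
  have hid : ∀ z : EuclideanSpace ℝ (Fin N) × EuclideanSpace ℝ (Fin N),
      (η z.1 - η z.2) * (u z.2 * φ z.1) * truncKer s ε (z.1 - z.2) +
        gagGrad s u z * (φ z.1 * (η z.1 - η z.2) * √(truncKer s ε (z.1 - z.2))) =
      (η z.1 - η z.2) * (u z.1 * φ z.1) * truncKer s ε (z.1 - z.2) := by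
    intro z
    have := sqrt_fracKer_mul_sqrt_truncKer s ε (z.1 - z.2)
    rw [gagGrad]
    linear_combination (u z.1 - u z.2) * φ z.1 * (η z.1 - η z.2) * this
  have hQ := hP.add hS
  have hsum := integral_add hP hS
  simp only [Pi.mul_apply] at hsum
  simp_rw [hid] at hsum
  have hQ' : Integrable (fun z : EuclideanSpace ℝ (Fin N) × EuclideanSpace ℝ (Fin N) =>
      (η z.1 - η z.2) * (u z.1 * φ z.1) * truncKer s ε (z.1 - z.2)) (volume.prod volume) :=
    hQ.congr (.of_forall hid)
  have hQle : |∫ z : EuclideanSpace ℝ (Fin N) × EuclideanSpace ℝ (Fin N),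
      (η z.1 - η z.2) * (u z.1 * φ z.1) * truncKer s ε (z.1 - z.2)| ≤
      B / 2 * kerMass N s * ((eLpNorm u 2 volume).toReal * (eLpNorm φ 2 volume).toReal) := by
    rw [Measure.volume_eq_prod, integral_prod _ hQ']
    have hin : ∀ x, ∫ y, (η x - η y) * (u x * φ x) * truncKer s ε (x - y) =
        (u x * φ x) * ∫ y, (η x - η y) * truncKer s ε (x - y) := by
      intro x
      rw [← integral_const_mul]
      congr 1; ext y; ring
    simp only [hin]
    have huφ : Integrable fun x => |u x * φ x| := (hu.integrable_mul hφ).abs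
    have h1 := norm_integral_le_of_norm_le (huφ.const_mul (B / 2 * kerMass N s))
      (f := fun x => (u x * φ x) * ∫ y, (η x - η y) * truncKer s ε (x - y))
      (.of_forall fun x => by
        rw [norm_mul, mul_comm]
        exact mul_le_mul_of_nonneg_right
          (hη.abs_integral_sub_mul_truncKer_le hN hs0 hs1 hε x) (norm_nonneg _))
    rw [integral_const_mul] at h1
    exact h1.trans (mul_le_mul_of_nonneg_left (integral_abs_mul_le hu hφ) (by positivity))
  have hSle := abs_integral_mul_le hu' hw
  have hSle' := hSle.trans (mul_le_mul_of_nonneg_left hw' ENNReal.toReal_nonneg)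
  have := _root_.abs_le.1 hQle
  have := _root_.abs_le.1 hSle'
  rw [_root_.abs_le]
  constructor <;> nlinarith

/-- The commutator of the energy form with multiplication by a cutoff is bounded in `L²`. -/
lemma IsCutoff.exists_commutator_bound (hN : 1 ≤ N) (hs0 : 0 < s) (hs1 : s < 1)
    (hη : IsCutoff η B) (hu : MemSobolev s u) :
    ∃ K : ℝ, 0 ≤ K ∧ ∀ φ, MemSobolev s φ →
      |energyForm s (fun x => η x * u x) φ - energyForm s u (fun x => η x * φ x)| ≤
        K * (eLpNorm φ 2 volume).toReal := by
  obtain ⟨hu1, hu2⟩ := (memSobolev_iff_memLp hs0 hs1).1 hu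
  have hB := hη.nonneg
  have hK := kerMass_nonneg (N := N) s
  have hc := fracLapConst_pos hN hs0 hs1
  set K₀ := B / 2 * kerMass N s * (eLpNorm u 2 volume).toReal +
        (eLpNorm (gagGrad s u) 2 volume).toReal * √(B * kerMass N s) with hK₀
  have hK₀' : 0 ≤ K₀ := by positivity
  refine ⟨fracLapConst N s * K₀, by positivity, fun φ hφ => ?_⟩
  obtain ⟨hφ1, hφ2⟩ := (memSobolev_iff_memLp hs0 hs1).1 hφ
  obtain ⟨-, hηu⟩ := (memSobolev_iff_memLp hs0 hs1).1 (hη.memSobolev_mul hN hs0 hs1 hu)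
  obtain ⟨-, hηφ⟩ := (memSobolev_iff_memLp hs0 hs1).1 (hη.memSobolev_mul hN hs0 hs1 hφ)
  have hsub := integral_sub (hηu.integrable_mul hφ2) (hu2.integrable_mul hηφ)
  have hJ := (hηu.integrable_mul hφ2).sub (hu2.integrable_mul hηφ)
  simp only [Pi.mul_apply] at hsub
  -- The terms carrying a difference of `η` are all that survive. The two products on the right need
  -- not be integrable separately against the full kernel, hence the truncation.
  have hJid : ∀ z, gagGrad s (fun x => η x * u x) z * gagGrad s φ z -
      gagGrad s u z * gagGrad s (fun x => η x * φ x) z =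
      (η z.1 - η z.2) * (u z.2 * φ z.1 - u z.1 * φ z.2) * fracKer s (z.1 - z.2) := by
    intro z
    rw [gagGrad_mul_gagGrad, gagGrad_mul_gagGrad]
    ring
  have hJ' : Integrable fun z : EuclideanSpace ℝ (Fin N) × EuclideanSpace ℝ (Fin N) =>
      (η z.1 - η z.2) * (u z.2 * φ z.1 - u z.1 * φ z.2) * fracKer s (z.1 - z.2) :=
    hJ.congr (.of_forall hJid)
  simp_rw [hJid] at hsub
  have hεbound : ∀ n : ℕ, |∫ z : EuclideanSpace ℝ (Fin N) × EuclideanSpace ℝ (Fin N),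
      (η z.1 - η z.2) * (u z.2 * φ z.1 - u z.1 * φ z.2) *
        truncKer s (1 / ((n : ℝ) + 1)) (z.1 - z.2)| ≤ 2 * (K₀ * (eLpNorm φ 2 volume).toReal) := by
    intro n
    have hε : 0 < 1 / ((n : ℝ) + 1) := by positivity
    have hP := hη.integrable_cross hN hs0 hs1 hε hu1 hφ1
    -- Exchanging `x` and `y` identifies the second product with the first, which gives the factor
    -- `2`.
    have hswap : ∫ z : EuclideanSpace ℝ (Fin N) × EuclideanSpace ℝ (Fin N),
        (η z.2 - η z.1) * (u z.1 * φ z.2) * truncKer s (1 / ((n : ℝ) + 1)) (z.2 - z.1) =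
        ∫ z : EuclideanSpace ℝ (Fin N) × EuclideanSpace ℝ (Fin N),
        (η z.1 - η z.2) * (u z.2 * φ z.1) * truncKer s (1 / ((n : ℝ) + 1)) (z.1 - z.2) :=
      integral_prod_swap (μ := volume) (ν := volume) (fun z :
        EuclideanSpace ℝ (Fin N) × EuclideanSpace ℝ (Fin N) =>
        (η z.1 - η z.2) * (u z.2 * φ z.1) * truncKer s (1 / ((n : ℝ) + 1)) (z.1 - z.2))
    have hP' : Integrable fun z : EuclideanSpace ℝ (Fin N) × EuclideanSpace ℝ (Fin N) =>
        (η z.2 - η z.1) * (u z.1 * φ z.2) * truncKer s (1 / ((n : ℝ) + 1)) (z.2 - z.1) :=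
      Integrable.swap (μ := volume) (ν := volume) hP
    have h2 : ∫ z : EuclideanSpace ℝ (Fin N) × EuclideanSpace ℝ (Fin N),
        (η z.1 - η z.2) * (u z.2 * φ z.1 - u z.1 * φ z.2) *
        truncKer s (1 / ((n : ℝ) + 1)) (z.1 - z.2) = 2 * ∫ z :
        EuclideanSpace ℝ (Fin N) × EuclideanSpace ℝ (Fin N),
        (η z.1 - η z.2) * (u z.2 * φ z.1) * truncKer s (1 / ((n : ℝ) + 1)) (z.1 - z.2) := by
      rw [two_mul]
      nth_rewrite 2 [← hswap]
      rw [← integral_add hP hP']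
      congr 1; ext z
      rw [← truncKer_neg s _ (z.2 - z.1), neg_sub]
      ring
    rw [h2, abs_mul, abs_two]
    gcongr
    exact hη.abs_integral_cross_le hN hs0 hs1 hε hu1 hu2 hφ1
  -- The truncation is removed by dominated convergence, with the absolute value of the full
  -- commutator integrand as dominating function; on the diagonal the integrand is zero.
  have hlim : Filter.Tendsto (fun n : ℕ =>
      ∫ z : EuclideanSpace ℝ (Fin N) × EuclideanSpace ℝ (Fin N),
      (η z.1 - η z.2) * (u z.2 * φ z.1 - u z.1 * φ z.2) *
        truncKer s (1 / ((n : ℝ) + 1)) (z.1 - z.2)) Filter.atTop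
      (nhds (∫ z : EuclideanSpace ℝ (Fin N) × EuclideanSpace ℝ (Fin N),
      (η z.1 - η z.2) * (u z.2 * φ z.1 - u z.1 * φ z.2) * fracKer s (z.1 - z.2))) := by
    refine tendsto_integral_of_dominated_convergence _ (fun n => ?_) hJ'.norm
      (fun n => .of_forall fun z => ?_) (.of_forall fun z => ?_)
    · have h1 : Measurable fun z : EuclideanSpace ℝ (Fin N) × EuclideanSpace ℝ (Fin N) =>
          truncKer s (1 / ((n : ℝ) + 1)) (z.1 - z.2) := by fun_prop
      have hηc := hη.continuous
      have h2 : Continuous fun z : EuclideanSpace ℝ (Fin N) × EuclideanSpace ℝ (Fin N) =>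
          η z.1 - η z.2 := by fun_prop
      rw [Measure.volume_eq_prod]
      exact (h2.aestronglyMeasurable.mul ((hu1.1.comp_snd.mul hφ1.1.comp_fst).sub
        (hu1.1.comp_fst.mul hφ1.1.comp_snd))).mul h1.aestronglyMeasurable
    · rw [norm_mul _ (truncKer _ _ _), norm_mul _ (fracKer _ _),
        Real.norm_of_nonneg (truncKer_nonneg _ _ _), Real.norm_of_nonneg (fracKer_nonneg _ _)]
      gcongr
      exact truncKer_le _ _ _
    · rcases eq_or_ne z.1 z.2 with hz | hz
      · simp [hz]
      · refine tendsto_const_nhds.congr' ?_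
        have hpos : 0 < ‖z.1 - z.2‖ := norm_pos_iff.2 (sub_ne_zero.2 hz)
        filter_upwards [tendsto_one_div_add_atTop_nhds_zero_nat.eventually_lt_const hpos] with n hn
        rw [truncKer, if_pos hn]
  have hfinal := le_of_tendsto hlim.abs (.of_forall hεbound)
  rw [energyForm_eq, energyForm_eq, ← mul_sub, ← hsub, abs_mul, abs_of_pos (by positivity)]
  calc _ ≤ fracLapConst N s / 2 * (2 * (K₀ * (eLpNorm φ 2 volume).toReal)) := by gcongr
    _ = _ := by ring

end

/-! ### Testing with truncated Fourier multipliers -/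

section

variable {N : ℕ} {F : Type*} [NormedAddCommGroup F]

lemma integrable_sq_mul_fracKer {σ : ℝ} {u : EuclideanSpace ℝ (Fin N) → F}
    (hu : AEStronglyMeasurable u volume) (h : seminormSq σ u < ∞) :
    Integrable fun z : EuclideanSpace ℝ (Fin N) × EuclideanSpace ℝ (Fin N) =>
      ‖u z.1 - u z.2‖ ^ 2 * fracKer σ (z.1 - z.2) := by
  have h1 := integrable_toReal_of_lintegral_ne_top (aemeasurable_seminormSq_integrand σ hu) h.ne
  refine h1.congr (.of_forall fun z => ?_)
  simp [fracKer_nonneg]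

lemma toReal_seminormSq {σ : ℝ} {u : EuclideanSpace ℝ (Fin N) → F}
    (hu : AEStronglyMeasurable u volume) (h : seminormSq σ u < ∞) :
    (seminormSq σ u).toReal = ∫ z : EuclideanSpace ℝ (Fin N) × EuclideanSpace ℝ (Fin N),
      ‖u z.1 - u z.2‖ ^ 2 * fracKer σ (z.1 - z.2) := by
  have hm := aemeasurable_seminormSq_integrand σ hu
  rw [seminormSq, ← integral_toReal hm (ae_lt_top' hm h.ne)]
  congr 1; ext z
  simp [fracKer_nonneg]

lemma seminormSq_ofReal (σ : ℝ) (u : EuclideanSpace ℝ (Fin N) → ℝ) :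
    seminormSq σ (fun x => (u x : ℂ)) = seminormSq σ u := by
  unfold seminormSq
  congr 1; ext z
  rw [← Complex.ofReal_sub, enorm_sq_eq_ofReal, enorm_sq_eq_ofReal, Complex.norm_real]

lemma seminormSq_re_le (σ : ℝ) (u : EuclideanSpace ℝ (Fin N) → ℂ) :
    seminormSq σ (fun x => (u x).re) ≤ seminormSq σ u := by
  refine lintegral_mono fun z => ?_
  simp only [enorm_sq_eq_ofReal]
  gcongr
  rw [← Complex.sub_re]
  exact Complex.abs_re_le_norm _

lemma eLpNorm_re_le {α : Type*} [MeasurableSpace α] {μ : Measure α} (u : α → ℂ) :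
    eLpNorm (fun x => (u x).re) 2 μ ≤ eLpNorm u 2 μ :=
  eLpNorm_mono fun x => Complex.abs_re_le_norm (u x)

lemma symbol_lt_top (hN : 1 ≤ N) {σ : ℝ} (h0 : 0 < σ) (h1 : σ < 1)
    (ξ : EuclideanSpace ℝ (Fin N)) : symbol σ ξ < ∞ :=
  (symbol_le hN h0 h1 ξ).trans_lt ENNReal.ofReal_lt_top

/-- The symbol truncated where it exceeds `R`. -/
noncomputable def truncSymbol (σ R : ℝ) (ξ : EuclideanSpace ℝ (Fin N)) : ℝ :=
  if (symbol σ ξ).toReal ≤ R then (symbol σ ξ).toReal else 0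

lemma truncSymbol_nonneg (σ R : ℝ) (ξ : EuclideanSpace ℝ (Fin N)) : 0 ≤ truncSymbol σ R ξ := by
  unfold truncSymbol; split_ifs <;> simp

lemma truncSymbol_le {σ R : ℝ} (hR : 0 ≤ R) (ξ : EuclideanSpace ℝ (Fin N)) :
    truncSymbol σ R ξ ≤ R := by
  unfold truncSymbol; split_ifs <;> assumption

lemma measurable_truncSymbol (σ R : ℝ) :
    Measurable (truncSymbol σ R : EuclideanSpace ℝ (Fin N) → ℝ) := by
  have h : Measurable fun ξ : EuclideanSpace ℝ (Fin N) => (symbol σ ξ).toReal :=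
    (measurable_symbol σ).ennreal_toReal
  exact Measurable.ite (measurableSet_le h measurable_const) h measurable_const

/-- Cutting the symbol off to `0`, rather than capping it at `R`, makes this an identity; it turns
the tested energy into an exact square. -/
lemma symbol_mul_truncSymbol (σ R : ℝ) (ξ : EuclideanSpace ℝ (Fin N)) :
    (symbol σ ξ).toReal * truncSymbol σ R ξ = truncSymbol σ R ξ ^ 2 := by
  unfold truncSymbol; split_ifs <;> ring

lemma memLp_truncSymbol_mul (σ : ℝ) {R : ℝ} (hR : 0 ≤ R)
    (w : Lp ℂ 2 (volume : Measure (EuclideanSpace ℝ (Fin N)))) :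
    MemLp (fun ξ => (truncSymbol σ R ξ : ℂ) * w ξ) 2 volume := by
  refine MemLp.mul (p := ∞) (q := 2) (Lp.memLp w) (memLp_top_of_bound
    (Complex.measurable_ofReal.comp (measurable_truncSymbol σ R)).aestronglyMeasurable R
    (.of_forall fun ξ => ?_))
  rw [Complex.norm_real, Real.norm_of_nonneg (truncSymbol_nonneg σ R ξ)]
  exact truncSymbol_le hR ξ

lemma toReal_seminormSq_eq_integral_symbol {σ : ℝ}
    {w : Lp ℂ 2 (volume : Measure (EuclideanSpace ℝ (Fin N)))} (hw : seminormSq σ w < ∞) :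
    Integrable (fun ξ => (symbol σ ξ).toReal *
      ‖(𝓕 w : Lp ℂ 2 (volume : Measure (EuclideanSpace ℝ (Fin N)))) ξ‖ ^ 2) ∧
    (seminormSq σ w).toReal = ∫ ξ, (symbol σ ξ).toReal *
      ‖(𝓕 w : Lp ℂ 2 (volume : Measure (EuclideanSpace ℝ (Fin N)))) ξ‖ ^ 2 := by
  have hm : AEMeasurable (fun ξ => symbol σ ξ *
      ‖(𝓕 w : Lp ℂ 2 (volume : Measure (EuclideanSpace ℝ (Fin N)))) ξ‖ₑ ^ 2) :=
    ((measurable_symbol σ).mul ((Lp.stronglyMeasurable _).enorm.pow_const 2)).aemeasurable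
  rw [seminormSq_eq_lintegral_symbol] at hw ⊢
  have e : ∀ ξ, (symbol σ ξ *
      ‖(𝓕 w : Lp ℂ 2 (volume : Measure (EuclideanSpace ℝ (Fin N)))) ξ‖ₑ ^ 2).toReal =
      (symbol σ ξ).toReal *
        ‖(𝓕 w : Lp ℂ 2 (volume : Measure (EuclideanSpace ℝ (Fin N)))) ξ‖ ^ 2 := fun ξ => by simp
  refine ⟨(integrable_toReal_of_lintegral_ne_top hm hw.ne).congr (.of_forall e), ?_⟩
  rw [← integral_toReal hm (ae_lt_top' hm hw.ne)]
  simp_rw [e]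

lemma seminormSq_add_lt_top {σ : ℝ} {u v : EuclideanSpace ℝ (Fin N) → F}
    (hu' : AEStronglyMeasurable u volume)
    (hu : seminormSq σ u < ∞) (hv : seminormSq σ v < ∞) : seminormSq σ (u + v) < ∞ := by
  have hle : seminormSq σ (u + v) ≤ 2 * seminormSq σ u + 2 * seminormSq σ v := by
    unfold seminormSq
    rw [← lintegral_const_mul' _ _ (by simp), ← lintegral_const_mul' _ _ (by simp),
      ← lintegral_add_left' ((aemeasurable_seminormSq_integrand σ hu').const_mul _)]
    refine lintegral_mono fun z => ?_
    simp only [Pi.add_apply]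
    rw [← mul_assoc, ← mul_assoc, ← add_mul]
    gcongr
    rw [enorm_sq_eq_ofReal, enorm_sq_eq_ofReal, enorm_sq_eq_ofReal, ← ENNReal.ofReal_ofNat,
      ← ENNReal.ofReal_mul (by positivity), ← ENNReal.ofReal_mul (by positivity),
      ← ENNReal.ofReal_add (by positivity) (by positivity)]
    refine ENNReal.ofReal_le_ofReal ?_
    have h := norm_add_le (u z.1 - u z.2) (v z.1 - v z.2)
    rw [show u z.1 + v z.1 - (u z.2 + v z.2) = (u z.1 - u z.2) + (v z.1 - v z.2) by abel]
    nlinarith [norm_nonneg (u z.1 - u z.2 + (v z.1 - v z.2)),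
      sq_nonneg (‖u z.1 - u z.2‖ - ‖v z.1 - v z.2‖)]
  exact hle.trans_lt (by finiteness)

lemma seminormSq_neg (σ : ℝ) (u : EuclideanSpace ℝ (Fin N) → F) :
    seminormSq σ (-u) = seminormSq σ u := by
  unfold seminormSq
  congr 1; ext z
  simp only [Pi.neg_apply]
  rw [show -u z.1 - -u z.2 = -(u z.1 - u z.2) by abel, enorm_neg]

/-- Polarization against the real part of a complex function. -/
lemma integral_gagGrad_mul_gagGrad_re {s : ℝ} {w : EuclideanSpace ℝ (Fin N) → ℝ}
    {Φ : EuclideanSpace ℝ (Fin N) → ℂ} (hw : AEStronglyMeasurable w volume)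
    (hΦ : AEStronglyMeasurable Φ volume) (hw' : seminormSq s w < ∞) (hΦ' : seminormSq s Φ < ∞) :
    4 * ∫ z, gagGrad s w z * gagGrad s (fun x => (Φ x).re) z =
      (seminormSq s ((fun x => (w x : ℂ)) + Φ)).toReal -
        (seminormSq s ((fun x => (w x : ℂ)) + -Φ)).toReal := by
  have hwc : AEStronglyMeasurable (fun x => (w x : ℂ)) volume :=
    Complex.continuous_ofReal.comp_aestronglyMeasurable hw
  have hwc' : seminormSq s (fun x => (w x : ℂ)) < ∞ := (seminormSq_ofReal s w).trans_lt hw'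
  have h1 := seminormSq_add_lt_top hwc hwc' hΦ'
  have h2 := seminormSq_add_lt_top hwc hwc' ((seminormSq_neg s Φ).trans_lt hΦ')
  rw [toReal_seminormSq (hwc.add hΦ) h1, toReal_seminormSq (hwc.add hΦ.neg) h2,
    ← integral_sub (integrable_sq_mul_fracKer (hwc.add hΦ) h1)
      (integrable_sq_mul_fracKer (hwc.add hΦ.neg) h2), ← integral_const_mul]
  congr 1; ext z
  rw [gagGrad_mul_gagGrad, ← sub_mul, ← mul_assoc]
  congr 1
  simp only [Pi.add_apply, Pi.neg_apply, ← Complex.normSq_eq_norm_sq, Complex.normSq_apply,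
    Complex.sub_re, Complex.add_re, Complex.neg_re, Complex.sub_im, Complex.add_im,
    Complex.neg_im, Complex.ofReal_re, Complex.ofReal_im]
  ring

lemma memLp_complex {w : EuclideanSpace ℝ (Fin N) → ℝ} (hw : MemLp w 2 volume) :
    MemLp (fun x => (w x : ℂ)) 2 volume := hw.ofReal

/-- The complexification of a real `L²` function. -/
noncomputable def toComplexLp {w : EuclideanSpace ℝ (Fin N) → ℝ} (hw : MemLp w 2 volume) :
    Lp ℂ 2 (volume : Measure (EuclideanSpace ℝ (Fin N))) := (memLp_complex hw).toLp

lemma coeFn_toComplexLp {w : EuclideanSpace ℝ (Fin N) → ℝ} (hw : MemLp w 2 volume) :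
    toComplexLp hw =ᵐ[volume] fun x => (w x : ℂ) := (memLp_complex hw).coeFn_toLp

lemma integral_norm_sq_eq (f : Lp ℂ 2 (volume : Measure (EuclideanSpace ℝ (Fin N)))) :
    ∫ x, ‖f x‖ ^ 2 = ‖f‖ ^ 2 := by
  have h := lintegral_enorm_sq_eq (μ := volume) f
  have hm : AEMeasurable fun x => ‖f x‖ₑ ^ 2 := ((Lp.memLp f).1.enorm.pow_const 2)
  have h2 := integral_toReal hm (ae_lt_top' hm (memLp_two_iff.1 (Lp.memLp f)).2.ne)
  rw [h, ENNReal.toReal_pow, ← Lp.norm_def] at h2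
  rw [← h2]
  simp

/-- With `m = truncSymbol s R · ŵ` and `φ = Re 𝓕⁻ m`, polarization and Plancherel give `𝓔(w, φ) =
(C_{N,s}/2) ‖m‖²`, while the hypothesis gives `𝓔(w, φ) ≤ K ‖m‖`. Dividing by `‖m‖` bounds it
uniformly in `R`. Truncation keeps `φ` in `W^{s,2}`; the real part is harmless because `w` is real.
-/
lemma norm_truncSymbol_le (hN : 1 ≤ N) {s : ℝ} (hs0 : 0 < s) (hs1 : s < 1)
    {w : EuclideanSpace ℝ (Fin N) → ℝ} (hw1 : MemLp w 2 volume) (hw2 : seminormSq s w < ∞)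
    {K : ℝ} (hK : 0 ≤ K)
    (hbound : ∀ φ, MemSobolev s φ → |energyForm s w φ| ≤ K * (eLpNorm φ 2 volume).toReal)
    {R : ℝ} (hR : 0 ≤ R) :
    ‖(memLp_truncSymbol_mul s hR (𝓕 (toComplexLp hw1))).toLp‖ ≤ 2 * K / fracLapConst N s := by
  have hc := fracLapConst_pos hN hs0 hs1
  set W : Lp ℂ 2 (volume : Measure (EuclideanSpace ℝ (Fin N))) := toComplexLp hw1 with hW
  have hWw : W =ᵐ[volume] fun x => (w x : ℂ) := coeFn_toComplexLp hw1
  have hWs : seminormSq s W < ∞ := by rwa [seminormSq_congr_ae hWw, seminormSq_ofReal]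
  set m := memLp_truncSymbol_mul s hR (𝓕 W)
  set Φ : Lp ℂ 2 (volume : Measure (EuclideanSpace ℝ (Fin N))) := 𝓕⁻ m.toLp with hΦ
  have hΦF : 𝓕 Φ = m.toLp := FourierTransform.fourier_fourierInv_eq _
  have hΦnorm : ‖Φ‖ = ‖m.toLp‖ := by rw [← hΦF, Lp.norm_fourier_eq]
  have hmF := m.coeFn_toLp
  have hΦs : seminormSq s Φ < ∞ := by
    have hle : seminormSq s Φ ≤ ENNReal.ofReal (R ^ 2) * seminormSq s W := by
      rw [seminormSq_eq_lintegral_symbol, seminormSq_eq_lintegral_symbol, hΦF,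
        ← lintegral_const_mul' _ _ ENNReal.ofReal_ne_top]
      refine lintegral_mono_ae ?_
      filter_upwards [hmF] with ξ hξ
      rw [hξ, enorm_mul, mul_pow, mul_left_comm]
      gcongr
      rw [enorm_sq_eq_ofReal, Complex.norm_real, Real.norm_of_nonneg (truncSymbol_nonneg _ _ _)]
      exact ENNReal.ofReal_le_ofReal
        (pow_le_pow_left₀ (truncSymbol_nonneg _ _ _) (truncSymbol_le hR ξ) 2)
    exact hle.trans_lt (by finiteness)
  have hφ1 : MemLp (fun x => (Φ x).re) 2 volume := (Lp.memLp Φ).re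
  have hφ : MemSobolev s fun x => (Φ x).re :=
    (memSobolev_iff hs0 hs1).2 ⟨hφ1, (seminormSq_re_le s Φ).trans_lt hΦs⟩
  have hφnorm : (eLpNorm (fun x => (Φ x).re) 2 volume).toReal ≤ ‖m.toLp‖ := by
    rw [← hΦnorm, Lp.norm_def]
    exact ENNReal.toReal_mono (Lp.memLp Φ).2.ne (eLpNorm_re_le Φ)
  have hadd : seminormSq s ((fun x => (w x : ℂ)) + ⇑Φ) = seminormSq s (W + Φ : Lp ℂ 2 volume) := by
    refine seminormSq_congr_ae ?_
    filter_upwards [hWw, Lp.coeFn_add W Φ] with x e1 e2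
    rw [e2, Pi.add_apply, Pi.add_apply, e1]
  have hsub : seminormSq s ((fun x => (w x : ℂ)) + -⇑Φ) =
      seminormSq s (W - Φ : Lp ℂ 2 volume) := by
    refine seminormSq_congr_ae ?_
    filter_upwards [hWw, Lp.coeFn_sub W Φ] with x e1 e2
    rw [e2, Pi.add_apply, Pi.neg_apply, Pi.sub_apply, e1, sub_eq_add_neg]
  have hwc : AEStronglyMeasurable (fun x => (w x : ℂ)) volume := (memLp_complex hw1).1
  have hwc' : seminormSq s (fun x => (w x : ℂ)) < ∞ := (seminormSq_ofReal s w).trans_lt hw2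
  have hadd' : seminormSq s (W + Φ : Lp ℂ 2 volume) < ∞ :=
    hadd ▸ seminormSq_add_lt_top hwc hwc' hΦs
  have hsub' : seminormSq s (W - Φ : Lp ℂ 2 volume) < ∞ :=
    hsub ▸ seminormSq_add_lt_top hwc hwc' ((seminormSq_neg s Φ).trans_lt hΦs)
  have hpol := integral_gagGrad_mul_gagGrad_re hw1.1 (Lp.memLp Φ).1 hw2 hΦs
  obtain ⟨i1, e1⟩ := toReal_seminormSq_eq_integral_symbol hadd'
  obtain ⟨i2, e2⟩ := toReal_seminormSq_eq_integral_symbol hsub'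
  have hFadd : 𝓕 (W + Φ) = 𝓕 W + m.toLp := by
    rw [← hΦF]; exact map_add (Lp.fourierTransformₗᵢ (EuclideanSpace ℝ (Fin N)) ℂ) _ _
  have hFsub : 𝓕 (W - Φ) = 𝓕 W - m.toLp := by
    rw [← hΦF]; exact map_sub (Lp.fourierTransformₗᵢ (EuclideanSpace ℝ (Fin N)) ℂ) _ _
  have hnormsq : ∫ ξ, ‖(m.toLp _) ξ‖ ^ 2 = ‖m.toLp‖ ^ 2 :=
    integral_norm_sq_eq _
  have hid : ∫ z, gagGrad s w z * gagGrad s (fun x => (Φ x).re) z = ‖m.toLp‖ ^ 2 := by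
    have h4 : 4 * ∫ z, gagGrad s w z * gagGrad s (fun x => (Φ x).re) z = 4 * ‖m.toLp‖ ^ 2 := by
      rw [hpol, hadd, hsub, e1, e2, ← integral_sub i1 i2, ← hnormsq, ← integral_const_mul]
      refine integral_congr_ae ?_
      rw [hFadd, hFsub]
      filter_upwards [hmF, Lp.coeFn_add (𝓕 W) m.toLp, Lp.coeFn_sub (𝓕 W) m.toLp]
        with ξ a1 a2 a3
      rw [a2, a3, Pi.add_apply, Pi.sub_apply, a1, ← one_add_mul, ← one_sub_mul, norm_mul,
        norm_mul, norm_mul, ← Complex.ofReal_one, ← Complex.ofReal_add, ← Complex.ofReal_sub,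
        Complex.norm_real, Complex.norm_real, Complex.norm_real, mul_pow, mul_pow, mul_pow,
        Real.norm_eq_abs, Real.norm_eq_abs, Real.norm_eq_abs, sq_abs, sq_abs, sq_abs,
        ← symbol_mul_truncSymbol]
      ring
    linarith
  have hb := hbound _ hφ
  rw [energyForm_eq, hid, abs_of_nonneg (by positivity)] at hb
  have hb' := hb.trans (mul_le_mul_of_nonneg_left hφnorm hK)
  rw [le_div_iff₀ hc]
  rcases (norm_nonneg m.toLp).eq_or_lt with h0 | h0
  · rw [← h0]; simpa using hK
  · nlinarith

end

/-! ### From Fourier decay to Sobolev regularity -/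

section

variable {N : ℕ}

/-- Monotone convergence as the truncation level `n` tends to infinity: the preceding bound does not
depend on the level, and at each `ξ` the truncation is eventually inactive. -/
lemma lintegral_symbol_sq_lt_top (hN : 1 ≤ N) {s : ℝ} (hs0 : 0 < s) (hs1 : s < 1)
    {w : EuclideanSpace ℝ (Fin N) → ℝ} (hw1 : MemLp w 2 volume) (hw2 : seminormSq s w < ∞)
    {K : ℝ} (hK : 0 ≤ K)
    (hbound : ∀ φ, MemSobolev s φ → |energyForm s w φ| ≤ K * (eLpNorm φ 2 volume).toReal) :
    ∫⁻ ξ, ENNReal.ofReal ((symbol s ξ).toReal ^ 2) *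
      ‖(𝓕 (toComplexLp hw1) : Lp ℂ 2 (volume : Measure (EuclideanSpace ℝ (Fin N)))) ξ‖ₑ ^ 2 < ∞ := by
  set V : Lp ℂ 2 (volume : Measure (EuclideanSpace ℝ (Fin N))) := 𝓕 (toComplexLp hw1) with hV
  have hVm : AEMeasurable fun ξ => ‖V ξ‖ₑ ^ 2 := (Lp.memLp V).1.enorm.pow_const 2
  set A := 2 * K / fracLapConst N s
  have hn : ∀ n : ℕ, ∫⁻ ξ, ENNReal.ofReal (truncSymbol s n ξ ^ 2) * ‖V ξ‖ₑ ^ 2 ≤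
      ENNReal.ofReal A ^ 2 := by
    intro n
    have h1 := norm_truncSymbol_le hN hs0 hs1 hw1 hw2 hK hbound (R := n) (Nat.cast_nonneg n)
    set m := memLp_truncSymbol_mul s (Nat.cast_nonneg n : (0 : ℝ) ≤ n) (𝓕 (toComplexLp hw1))
    calc ∫⁻ ξ, ENNReal.ofReal (truncSymbol s n ξ ^ 2) * ‖V ξ‖ₑ ^ 2
        = ∫⁻ ξ, ‖(truncSymbol s n ξ : ℂ) * V ξ‖ₑ ^ 2 := by
          congr 1; ext ξ
          rw [enorm_mul, mul_pow, enorm_sq_eq_ofReal (truncSymbol s n ξ : ℂ), Complex.norm_real,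
            Real.norm_of_nonneg (truncSymbol_nonneg _ _ _)]
      _ = ‖m.toLp‖ₑ ^ 2 := by rw [lintegral_enorm_sq_eq, Lp.enorm_toLp]
      _ ≤ ENNReal.ofReal A ^ 2 := by
          rw [← ofReal_norm]
          gcongr
  have hlim := lintegral_tendsto_of_tendsto_of_monotone (μ := volume)
    (f := fun (n : ℕ) ξ => ENNReal.ofReal (truncSymbol s n ξ ^ 2) * ‖V ξ‖ₑ ^ 2)
    (F := fun ξ => ENNReal.ofReal ((symbol s ξ).toReal ^ 2) * ‖V ξ‖ₑ ^ 2)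
    (fun n => (((measurable_truncSymbol s n).pow_const 2).ennreal_ofReal.aemeasurable.mul hVm))
    (.of_forall fun ξ n k hnk => by
      dsimp only
      gcongr
      · exact truncSymbol_nonneg _ _ _
      · have hnk' : (n : ℝ) ≤ k := Nat.cast_le.2 hnk
        unfold truncSymbol
        split_ifs with h1 h2
        · exact le_rfl
        · exact absurd (h1.trans hnk') h2
        · exact ENNReal.toReal_nonneg
        · exact le_rfl)
    (.of_forall fun ξ => by
      refine tendsto_const_nhds.congr' ?_
      obtain ⟨n₀, hn₀⟩ := exists_nat_ge (symbol s ξ).toReal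
      filter_upwards [Filter.eventually_ge_atTop n₀] with n hn
      rw [truncSymbol, if_pos (hn₀.trans (Nat.cast_le.2 hn))])
  exact (le_of_tendsto hlim (.of_forall hn)).trans_lt (by finiteness)

lemma lintegral_rpow_lt_top (hN : 1 ≤ N) {s : ℝ} (hs0 : 0 < s) (hs1 : s < 1)
    {V : EuclideanSpace ℝ (Fin N) → ℂ}
    (hV : ∫⁻ ξ, ENNReal.ofReal ((symbol s ξ).toReal ^ 2) * ‖V ξ‖ₑ ^ 2 < ∞) :
    ∫⁻ ξ, ENNReal.ofReal (‖ξ‖ ^ (4 * s)) * ‖V ξ‖ₑ ^ 2 < ∞ := by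
  obtain ⟨c, hc0, hc⟩ := exists_le_symbol (N := N) hN hs0
  have hle : ∫⁻ ξ, ENNReal.ofReal (‖ξ‖ ^ (4 * s)) * ‖V ξ‖ₑ ^ 2 ≤
      ENNReal.ofReal ((c ^ 2)⁻¹) *
        ∫⁻ ξ, ENNReal.ofReal ((symbol s ξ).toReal ^ 2) * ‖V ξ‖ₑ ^ 2 := by
    rw [← lintegral_const_mul' _ _ ENNReal.ofReal_ne_top]
    refine lintegral_mono fun ξ => ?_
    dsimp only
    rw [← mul_assoc, ← ENNReal.ofReal_mul (by positivity)]
    gcongr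
    have h1 : c * ‖ξ‖ ^ (2 * s) ≤ (symbol s ξ).toReal :=
      (ENNReal.ofReal_le_iff_le_toReal (symbol_lt_top hN hs0 hs1 ξ).ne).1 (hc ξ)
    have h2 : ‖ξ‖ ^ (4 * s) = (‖ξ‖ ^ (2 * s)) ^ 2 := by
      rw [← Real.rpow_natCast, ← Real.rpow_mul (norm_nonneg _)]
      congr 1; push_cast; ring
    rw [h2, ← div_eq_inv_mul, le_div_iff₀ (by positivity), mul_comm, ← mul_pow]
    gcongr
  exact hle.trans_lt (by finiteness)

lemma seminormSq_lt_top_of_fourier (hN : 1 ≤ N) {σ : ℝ} (h0 : 0 < σ) (h1 : σ < 1)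
    {w : Lp ℂ 2 (volume : Measure (EuclideanSpace ℝ (Fin N)))}
    (hw : ∫⁻ ξ, ENNReal.ofReal (‖ξ‖ ^ (2 * σ)) *
      ‖(𝓕 w : Lp ℂ 2 (volume : Measure (EuclideanSpace ℝ (Fin N)))) ξ‖ₑ ^ 2 < ∞) :
    seminormSq σ w < ∞ := by
  have hle : seminormSq σ w ≤ ENNReal.ofReal (4 * Real.pi ^ 2 * kerMass N σ) *
      ∫⁻ ξ, ENNReal.ofReal (‖ξ‖ ^ (2 * σ)) *
        ‖(𝓕 w : Lp ℂ 2 (volume : Measure (EuclideanSpace ℝ (Fin N)))) ξ‖ₑ ^ 2 := by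
    rw [seminormSq_eq_lintegral_symbol, ← lintegral_const_mul' _ _ ENNReal.ofReal_ne_top]
    refine lintegral_mono fun ξ => ?_
    have := kerMass_nonneg (N := N) σ
    rw [← mul_assoc, ← ENNReal.ofReal_mul (by positivity)]
    gcongr
    exact symbol_le hN h0 h1 ξ
  exact hle.trans_lt (by finiteness)

/-- A real `L²` function whose Fourier transform is multiplied by `2πi ξᵢ` in `L²` has the
corresponding weak derivative. -/
lemma hasWeakPartialDeriv_of_fourier (i : Fin N) {w : EuclideanSpace ℝ (Fin N) → ℝ}
    (hw : MemLp w 2 volume) {G : Lp ℂ 2 (volume : Measure (EuclideanSpace ℝ (Fin N)))}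
    (hG : (𝓕 G : Lp ℂ 2 (volume : Measure (EuclideanSpace ℝ (Fin N)))) =ᵐ[volume]
      fun ξ => (2 * Real.pi * Complex.I * (ξ i : ℂ)) *
        (𝓕 (toComplexLp hw) : Lp ℂ 2 (volume : Measure (EuclideanSpace ℝ (Fin N)))) ξ) :
    HasWeakPartialDeriv i w fun x => (G x).re := by
  have hGre : MemLp (fun x => (G x).re) 2 volume := (Lp.memLp G).re
  refine ⟨hw.locallyIntegrable (by norm_num), hGre.locallyIntegrable (by norm_num), fun φ => ?_⟩
  have hφd : Differentiable ℝ φ := φ.contDiff.differentiable (by simp)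
  set e : EuclideanSpace ℝ (Fin N) := EuclideanSpace.single i (1 : ℝ)
  have hcs : HasCompactSupport fun x => (φ x : ℂ) :=
    φ.hasCompactSupport.comp_left (g := ((↑) : ℝ → ℂ)) Complex.ofReal_zero
  have hcd : ContDiff ℝ ((⊤ : ℕ∞) : WithTop ℕ∞) fun x => (φ x : ℂ) :=
    Complex.ofRealCLM.contDiff.comp φ.contDiff
  set Φ : 𝓢(EuclideanSpace ℝ (Fin N), ℂ) := hcs.toSchwartzMap hcd
  have hΦ : ∀ x, Φ x = (φ x : ℂ) := fun x => rfl
  set Ψ : 𝓢(EuclideanSpace ℝ (Fin N), ℂ) := LineDeriv.lineDerivOp e Φ with hΨdef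
  have hΨ : ∀ x, Ψ x = (fderiv ℝ (fun y => φ y) x e : ℂ) := by
    intro x
    rw [hΨdef, SchwartzMap.lineDerivOp_apply_eq_fderiv]
    have h1 : HasFDerivAt (fun x => (φ x : ℂ)) (Complex.ofRealCLM.comp (fderiv ℝ φ x)) x :=
      Complex.ofRealCLM.hasFDerivAt.comp x (hφd x).hasFDerivAt
    have h2 : fderiv ℝ Φ x = Complex.ofRealCLM.comp (fderiv ℝ φ x) := h1.fderiv
    rw [h2]
    rfl
  -- Integration by parts becomes Parseval: the transform of `Ψ` is `2πi ξᵢ` times that of `Φ`, and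
  -- moving this factor to the second slot conjugates it, which yields the minus sign.
  have hinner : inner ℂ (Ψ.toLp 2 volume) (toComplexLp hw) = -inner ℂ (Φ.toLp 2 volume) G := by
    rw [← Lp.inner_fourier_eq, ← Lp.inner_fourier_eq (Φ.toLp 2 volume) G,
      SchwartzMap.toLp_fourier_eq, SchwartzMap.toLp_fourier_eq, hΨdef,
      SchwartzMap.fourier_lineDerivOp_eq, L2.inner_def, L2.inner_def, ← integral_neg]
    refine integral_congr_ae ?_
    filter_upwards [hG, (𝓕 Φ).coeFn_toLp 2 volume, ((2 * Real.pi * Complex.I) •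
      SchwartzMap.smulLeftCLM ℂ (inner ℝ · e) (𝓕 Φ)).coeFn_toLp 2 volume] with ξ e1 e2 e3
    have htg : (inner ℝ · e : EuclideanSpace ℝ (Fin N) → ℝ).HasTemperateGrowth := by fun_prop
    rw [e1, e2, e3, smul_apply, SchwartzMap.smulLeftCLM_apply_apply htg]
    have hξ : inner ℝ ξ e = ξ i := (EuclideanSpace.inner_single_right i 1 ξ).trans (by simp)
    rw [hξ]
    simp only [RCLike.inner_apply, smul_eq_mul, map_mul, Complex.real_smul, Complex.conj_ofReal,
      Complex.conj_I, map_ofNat]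
    ring
  have hl : inner ℂ (Ψ.toLp 2 volume) (toComplexLp hw) =
      ((∫ x, w x * fderiv ℝ (fun y => φ y) x e : ℝ) : ℂ) := by
    rw [L2.inner_def, ← integral_complex_ofReal]
    refine integral_congr_ae ?_
    filter_upwards [Ψ.coeFn_toLp 2 volume, coeFn_toComplexLp hw] with x e1 e2
    rw [e1, e2, hΨ]
    simp
  have hr : (inner ℂ (Φ.toLp 2 volume) G).re = ∫ x, (G x).re * φ x := by
    have hint := L2.integrable_inner (𝕜 := ℂ) (Φ.toLp 2 volume) G
    rw [L2.inner_def]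
    refine (integral_re hint).symm.trans (integral_congr_ae ?_)
    filter_upwards [Φ.coeFn_toLp 2 volume] with x e1
    rw [e1, hΦ]
    simp
  have := congrArg Complex.re hinner
  rw [hl, Complex.neg_re, hr, Complex.ofReal_re] at this
  exact this

/-- The derivative is the real part of the inverse transform of `2πi ξᵢ V`. It is in `L²` because
`|ξ|² ≤ 1 + |ξ|^(2r)` for `r ≥ 1`, and has a finite seminorm of order `r - 1 > 0` because
`|ξ|^(2(r-1)) |ξ|² = |ξ|^(2r)`. When `r = 1` no seminorm is required. -/
lemma exists_weak_partialDeriv {r : ℝ} (hr : 1 ≤ r) (i : Fin N) (hN : 1 ≤ N) (hr2 : r < 2)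
    {w : EuclideanSpace ℝ (Fin N) → ℝ} (hw : MemLp w 2 volume)
    (hF : ∫⁻ ξ, ENNReal.ofReal (‖ξ‖ ^ (2 * r)) *
      ‖(𝓕 (toComplexLp hw) : Lp ℂ 2 (volume : Measure (EuclideanSpace ℝ (Fin N)))) ξ‖ₑ ^ 2 < ∞) :
    ∃ g, HasWeakPartialDeriv i w g ∧ MemSobolevAux (r - 1) 0 g := by
  set V : Lp ℂ 2 (volume : Measure (EuclideanSpace ℝ (Fin N))) := 𝓕 (toComplexLp hw) with hV
  have hVfin : ∫⁻ ξ, ‖V ξ‖ₑ ^ 2 < ∞ := (memLp_two_iff.1 (Lp.memLp V)).2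
  have hmul : ∀ ξ : EuclideanSpace ℝ (Fin N),
      ‖(2 * Real.pi * Complex.I * (ξ i : ℂ)) * V ξ‖ₑ ^ 2 ≤
        ENNReal.ofReal (4 * Real.pi ^ 2) * (ENNReal.ofReal (‖ξ‖ ^ 2) * ‖V ξ‖ₑ ^ 2) := by
    intro ξ
    rw [enorm_mul, mul_pow, enorm_sq_eq_ofReal (2 * Real.pi * Complex.I * (ξ i : ℂ)), ← mul_assoc,
      ← ENNReal.ofReal_mul (by positivity)]
    gcongr
    have h1 : |ξ i| ≤ ‖ξ‖ := by simpa using EuclideanSpace.norm_eq ξ ▸ PiLp.norm_apply_le ξ i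
    have h2 : ‖(2 * Real.pi * Complex.I * (ξ i : ℂ))‖ = 2 * Real.pi * |ξ i| := by
      simp [abs_of_pos Real.pi_pos]
    rw [h2]
    calc (2 * Real.pi * |ξ i|) ^ 2 ≤ (2 * Real.pi * ‖ξ‖) ^ 2 := by gcongr
      _ = _ := by ring
  have hM : MemLp (fun ξ => (2 * Real.pi * Complex.I * (ξ i : ℂ)) * V ξ) 2 volume := by
    refine memLp_two_iff.2 ⟨?_, ?_⟩
    · have : Continuous fun ξ : EuclideanSpace ℝ (Fin N) =>
          (2 * Real.pi * Complex.I * (ξ i : ℂ)) := by fun_prop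
      exact this.aestronglyMeasurable.mul (Lp.memLp V).1
    · have hle : ∫⁻ ξ, ‖(2 * Real.pi * Complex.I * (ξ i : ℂ)) * V ξ‖ₑ ^ 2 ≤
          ENNReal.ofReal (4 * Real.pi ^ 2) * (∫⁻ ξ, ‖V ξ‖ₑ ^ 2 +
            ENNReal.ofReal (‖ξ‖ ^ (2 * r)) * ‖V ξ‖ₑ ^ 2) := by
        rw [← lintegral_const_mul' _ _ ENNReal.ofReal_ne_top]
        refine lintegral_mono fun ξ => (hmul ξ).trans ?_
        rw [← one_add_mul, ← ENNReal.ofReal_one, ← ENNReal.ofReal_add (by positivity)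
          (by positivity)]
        gcongr
        rcases le_total ‖ξ‖ 1 with h | h
        · have h1 := Real.rpow_nonneg (norm_nonneg ξ) (2 * r)
          nlinarith [norm_nonneg ξ]
        · have h1 : ‖ξ‖ ^ (2 : ℝ) ≤ ‖ξ‖ ^ (2 * r) :=
            Real.rpow_le_rpow_of_exponent_le h (by linarith)
          rw [Real.rpow_two] at h1
          linarith
      refine hle.trans_lt ?_
      rw [lintegral_add_left' ((Lp.memLp V).1.enorm.pow_const 2)]
      finiteness
  set G : Lp ℂ 2 (volume : Measure (EuclideanSpace ℝ (Fin N))) := 𝓕⁻ hM.toLp with hG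
  have hGF : 𝓕 G = hM.toLp := FourierTransform.fourier_fourierInv_eq _
  have hGae := hM.coeFn_toLp
  rw [← hGF] at hGae
  refine ⟨fun x => (G x).re, hasWeakPartialDeriv_of_fourier i hw hGae, (Lp.memLp G).re,
    fun hr1 => ?_⟩
  rw [gagliardoSq_eq_seminormSq]
  refine (seminormSq_re_le _ _).trans_lt
    (seminormSq_lt_top_of_fourier hN hr1 (by linarith) ?_)
  have hle : ∫⁻ ξ, ENNReal.ofReal (‖ξ‖ ^ (2 * (r - 1))) *
      ‖(𝓕 G : Lp ℂ 2 (volume : Measure (EuclideanSpace ℝ (Fin N)))) ξ‖ₑ ^ 2 ≤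
      ENNReal.ofReal (4 * Real.pi ^ 2) *
        ∫⁻ ξ, ENNReal.ofReal (‖ξ‖ ^ (2 * r)) * ‖V ξ‖ₑ ^ 2 := by
    rw [← lintegral_const_mul' _ _ ENNReal.ofReal_ne_top]
    refine lintegral_mono_ae ?_
    filter_upwards [hGae] with ξ hξ
    rw [hξ]
    refine (mul_le_mul_right (hmul ξ) _).trans (le_of_eq ?_)
    rw [mul_left_comm, ← mul_assoc (ENNReal.ofReal (‖ξ‖ ^ (2 * (r - 1)))),
      ← ENNReal.ofReal_mul (by positivity)]
    congr 3
    rw [← Real.rpow_two, ← Real.rpow_add_of_nonneg (norm_nonneg ξ) (by linarith) (by norm_num)]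
    ring_nf
  exact hle.trans_lt (by finiteness)

lemma memSobolev_two_mul (hN : 1 ≤ N) {s : ℝ} (hs0 : 0 < s) (hs1 : s < 1)
    {w : EuclideanSpace ℝ (Fin N) → ℝ} (hw : MemLp w 2 volume)
    (hF : ∫⁻ ξ, ENNReal.ofReal (‖ξ‖ ^ (4 * s)) *
      ‖(𝓕 (toComplexLp hw) : Lp ℂ 2 (volume : Measure (EuclideanSpace ℝ (Fin N)))) ξ‖ₑ ^ 2 < ∞) :
    MemSobolev (2 * s) w := by
  rw [show 4 * s = 2 * (2 * s) by ring] at hF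
  rcases lt_or_ge (2 * s) 1 with h | h
  · rw [memSobolev_iff (by linarith) h]
    refine ⟨hw, ?_⟩
    rw [← seminormSq_ofReal, ← seminormSq_congr_ae (coeFn_toComplexLp hw)]
    exact seminormSq_lt_top_of_fourier hN (by linarith) h hF
  · have h1 : ⌊2 * s⌋₊ = 1 := (Nat.floor_eq_iff (by linarith)).2 ⟨by simpa using h, by
      push_cast; linarith⟩
    have h2 : Int.fract (2 * s) = 2 * s - 1 := by
      rw [Int.fract_eq_iff]
      exact ⟨by linarith, by linarith, 1, by push_cast; ring⟩
    rw [MemSobolev, h1, h2]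
    exact ⟨hw, fun i => exists_weak_partialDeriv h i hN (by linarith) hw hF⟩

variable {Ω : TopologicalSpace.Opens (EuclideanSpace ℝ (Fin N))}

/-- For any `φ ∈ W^{s,2}(ℝ^N)` the product `ηφ` vanishes outside `Ω`, so the equation may be tested
with it. Then `𝓔(ηu, φ)` is `∫ fηφ` plus the commutator, each at most a constant times `‖φ‖₂`; the
constants are `A * B` and `K`. -/
lemma IsWeakSolution.memSobolevLoc (hN : 1 ≤ N) {s : ℝ} (hs0 : 0 < s) (hs1 : s < 1)
    {f u : EuclideanSpace ℝ (Fin N) → ℝ}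
    (hf : MemLp f 2 (volume.restrict (Ω : Set (EuclideanSpace ℝ (Fin N)))))
    (hu : IsWeakSolution s Ω f u) : MemSobolevLoc (2 * s) Ω u := by
  obtain ⟨hu1, hu2⟩ := (memSobolev_iff hs0 hs1).1 hu.1.1
  refine ⟨hu1.restrict _, fun η => ?_⟩
  obtain ⟨B, hη⟩ := exists_isCutoff η.contDiff η.hasCompactSupport
  have hB := hη.nonneg
  obtain ⟨K, hK, hcomm⟩ := hη.exists_commutator_bound hN hs0 hs1 hu.1.1
  obtain ⟨hw1, hw2⟩ := (memSobolev_iff hs0 hs1).1 (hη.memSobolev_mul hN hs0 hs1 hu.1.1)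
  set A := (eLpNorm f 2 (volume.restrict (Ω : Set (EuclideanSpace ℝ (Fin N))))).toReal
  refine memSobolev_two_mul hN hs0 hs1 hw1 (lintegral_rpow_lt_top hN hs0 hs1
    (lintegral_symbol_sq_lt_top hN hs0 hs1 hw1 hw2 (K := K + A * B) (by positivity)
      fun φ hφ => ?_))
  have hφ1 := ((memSobolev_iff hs0 hs1).1 hφ).1
  have hηφ : MemSobolevZero s Ω fun x => η x * φ x :=
    ⟨hη.memSobolev_mul hN hs0 hs1 hφ, .of_forall fun x hx => by
      simp [image_eq_zero_of_notMem_tsupport fun h => hx (η.tsupport_subset h)]⟩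
  have h1 := hcomm φ hφ
  rw [hu.2 _ hηφ] at h1
  have hηφ1 := hη.memLp_mul hφ1
  have h2 := abs_integral_mul_le hf (hηφ1.restrict (Ω : Set (EuclideanSpace ℝ (Fin N))))
  have h3 : (eLpNorm (fun x => η x * φ x) 2
      (volume.restrict (Ω : Set (EuclideanSpace ℝ (Fin N))))).toReal ≤
      B * (eLpNorm φ 2 volume).toReal := by
    have h4 : eLpNorm (fun x => η x * φ x) 2
        (volume.restrict (Ω : Set (EuclideanSpace ℝ (Fin N)))) ≤
        ENNReal.ofReal B * eLpNorm φ 2 volume :=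
      (eLpNorm_mono_measure _ Measure.restrict_le_self).trans
        (eLpNorm_le_mul_eLpNorm_of_ae_le_mul (.of_forall fun x => by
          rw [norm_mul]
          exact mul_le_mul_of_nonneg_right (hη.abs_le x) (norm_nonneg _)) 2)
    have h5 := ENNReal.toReal_mono (ENNReal.mul_ne_top ENNReal.ofReal_ne_top hφ1.2.ne) h4
    rwa [ENNReal.toReal_mul, ENNReal.toReal_ofReal hB] at h5
  have h6 := h2.trans (mul_le_mul_of_nonneg_left h3 ENNReal.toReal_nonneg)
  have h7 := _root_.abs_le.1 h1
  have h8 := _root_.abs_le.1 h6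
  rw [_root_.abs_le]
  constructor <;> linarith

end

end FracDirichlet

theorem theorem1p3 {N : ℕ} (hN : 1 ≤ N) (s : ℝ) (hs0 : 0 < s) (hs1 : s < 1)
    (Ω : TopologicalSpace.Opens (EuclideanSpace ℝ (Fin N)))
    (hΩ : Bornology.IsBounded (Ω : Set (EuclideanSpace ℝ (Fin N))))
    (f : EuclideanSpace ℝ (Fin N) → ℝ)
    (hf : MemLp f 2 (volume.restrict (Ω : Set (EuclideanSpace ℝ (Fin N))))) :
    (∃ u, FracDirichlet.IsWeakSolution s Ω f u) ∧
    (∀ u₁ u₂, FracDirichlet.IsWeakSolution s Ω f u₁ → FracDirichlet.IsWeakSolution s Ω f u₂ →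
      u₁ =ᵐ[volume] u₂) ∧
    (∀ u, FracDirichlet.IsWeakSolution s Ω f u → FracDirichlet.MemSobolevLoc (2 * s) Ω u) := by
  refine ⟨FracDirichlet.exists_weakSolution hN hs0 hs1 hΩ hf, fun u₁ u₂ h₁ h₂ =>
    FracDirichlet.weakSolution_unique hN hs0 hs1 hΩ h₁ h₂, fun u hu =>
    hu.memSobolevLoc hN hs0 hs1 hf⟩
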